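/- **Theorem 1.** Let $G_H$ be the complex Heisenberg group of matrices $\begin{pmatrix}1&\zeta_1&\zeta_3\\0&1&\zeta_2\\0&0&1\end{pmatrix}$, $\zeta_i\in\mathbb C$, let $\Gamma$ be the subgroup with Gaussian integer entries, and let $M=\Gamma\backslash G_H$ be the Iwasawa manifold. Let $e^1,\dots,e^6$ be the invariant real 1-forms with $e^1+ie^2=d\zeta_1$, $e^3+ie^4=d\zeta_2$, $e^5+ie^6=-d\zeta_3+\zeta_1d\zeta_2$; write $e^{ij}=e^i\wedge e^j$, and give $M$ the metric $g=\sum_i e^i\otimes e^i$ and the orientation $e^{123456}$. Let $\mathcal Z$ be the set of invariant, $g$-orthogonal almost complex structures $J$ on $M$ (those with constant coefficients in the frame dual to $(e^i)$) that are compatible with the orientation, and let $\omega(X,Y)=g(JX,Y)$ be the fundamental 2-form of $J$. Let $\nabla$ be the Levi-Civita connection, and let $\mathcal W=\mathcal W_1\oplus\mathcal W_2\oplus\mathcal W_3\oplus\mathcal W_4$ be the Gray–Hervella decomposition, determined by $(g,J)$, of the space of tensors with the symmetries of $\nabla\omega$. Put $\mathcal Z_{ijk}=\{J\in\mathcal Z:\nabla\omega\in\mathcal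 W_i\oplus\mathcal W_j\oplus\mathcal W_k\}$ and $\mathcal Z_2=\{J\in\mathcal Z:\nabla\omega\in\mathcal W_2\}$ (the almost Kähler structures). Let $v^0,\dots,v^3$ be the standard basis of $\mathbb C^4$ and identify $\Lambda^2\mathbb C^4$ with the space of complex invariant 1-forms by $2v^{01}=e^1+ie^2$, $2v^{23}=e^1-ie^2$, $2v^{02}=e^3+ie^4$, $2v^{31}=e^3-ie^4$, $2v^{03}=e^5+ie^6$, $2v^{12}=e^5-ie^6$, where $v^{ij}=v^i\wedge v^j$. Then there is a bijection $\mathbb{CP}^3\to\mathcal Z$ that sends $[u]$ to the structure $J$ for which the $i$-eigenspace of $\alpha\mapsto\alpha\circ J$ is $V_u=\{u\wedge v:v\in\mathbb C^4\}$. The points $[v^0],[v^1],[v^2],[v^3]$ correspond to the structures (the vertices of a tetrahedron) with fundamental forms $$\omega_0=e^{12}+e^{34}+e^{56},\quad \omega_1=e^{12}-e^{34}-e^{56},\quad \omega_2=-e^{12}+e^{34}-e^{56},\quad \omega_3=-e^{12}-e^{34}+e^{56}.$$ Label points of $\mathcal Z$ by their fundamental forms. Let the face $\mathcal F_i\cong\mathbb{CP}^2$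 be the projective plane $u_i=0$, which is opposite to $\omega_i$, and let the edge $\mathcal E_{ij}\cong\mathbb{CP}^1$ be the projective line through $\omega_i$ and $\omega_j$. For $P\in SO(4)$ acting on $\langle e^1,\dots,e^4\rangle$, put $f^j=P(e^j)$, and let $\mathcal S\subset\mathcal Z$ be the set of structures with fundamental form $$e^5\wedge f^1+f^2\wedge e^6+f^3\wedge f^4,$$ where $P\in SO(4)$ is such that the coefficient of $e^{12}+e^{34}$ in $P(e^{12}+e^{34})$, with respect to the basis $e^{12}+e^{34},\ e^{13}+e^{42},\ e^{14}+e^{23}$ of the self-dual 2-forms on $\langle e^1,\dots,e^4\rangle$, is $1$. Then $$\mathcal Z_{234}=\mathcal F_3,\qquad \mathcal Z_{134}=\{\omega_0\}\cup\mathcal E_{12},\qquad \mathcal Z_{124}=\{\omega_3\}\cup\mathcal S,\qquad \mathcal Z_{123}=\mathcal F_0\cup\mathcal F_3.$$ Moreover $\mathcal S=\mathcal Z_2$ is the set of almost Kähler structures, and it is homeomorphic to the 3-sphere. -/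

import Mathlib

noncomputable section

namespace Iwasawa

open Matrix

/-! ### The complex Heisenberg group and the Iwasawa manifold -/

/-- The complex coordinates `(ζ₁, ζ₂, ζ₃)`, with indices `0, 1, 2`. This is a real
6-dimensional vector space. -/
abbrev Coord : Type := Fin 3 → ℂ

/-- The complex Heisenberg group, each element given by its coordinates. -/
@[ext]
structure HeisenbergGroup where
  /-- the coordinates `(ζ₁, ζ₂, ζ₃)` -/
  coord : Coord

namespace HeisenbergGroup

/-- The unipotent matrix with coordinates `(ζ₁, ζ₂, ζ₃)`. -/
def toMatrix (a : HeisenbergGroup) : Matrix (Fin 3) (Fin 3) ℂ :=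
  !![1, a.coord 0, a.coord 2; 0, 1, a.coord 1; 0, 0, 1]

/-- Left translation by `a`, in coordinates. -/
def leftTranslation (a : HeisenbergGroup) (z : Coord) : Coord :=
  ![a.coord 0 + z 0, a.coord 1 + z 1, a.coord 2 + z 2 + a.coord 0 * z 1]

instance : Mul HeisenbergGroup := ⟨fun a b => ⟨leftTranslation a b.coord⟩⟩
instance : One HeisenbergGroup := ⟨⟨![0, 0, 0]⟩⟩
instance : Inv HeisenbergGroup :=
  ⟨fun a => ⟨![-a.coord 0, -a.coord 1, -a.coord 2 + a.coord 0 * a.coord 1]⟩⟩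

theorem coord_mul (a b : HeisenbergGroup) : (a * b).coord = leftTranslation a b.coord := rfl
theorem coord_one : (1 : HeisenbergGroup).coord = ![0, 0, 0] := rfl
theorem coord_inv (a : HeisenbergGroup) :
    (a⁻¹).coord = ![-a.coord 0, -a.coord 1, -a.coord 2 + a.coord 0 * a.coord 1] := rfl

/-- The product is the matrix product. -/
theorem toMatrix_mul (a b : HeisenbergGroup) : (a * b).toMatrix = a.toMatrix * b.toMatrix := by
  ext i j
  fin_cases i <;> fin_cases j <;>
    simp [toMatrix, coord_mul, leftTranslation, Matrix.mul_apply, Fin.sum_univ_three] <;> ring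

instance : Group HeisenbergGroup :=
  Group.ofLeftAxioms
    (by
      intro a b c
      ext i
      fin_cases i <;> simp [coord_mul, leftTranslation] <;> ring)
    (by
      intro a
      ext i
      fin_cases i <;> simp [coord_mul, coord_one, leftTranslation])
    (by
      intro a
      ext i
      fin_cases i <;> simp [coord_mul, coord_one, coord_inv, leftTranslation])

end HeisenbergGroup

/-- A complex number that is a Gaussian integer. -/
def IsGaussian (z : ℂ) : Prop := ∃ m n : ℤ, z = m + n * Complex.I

/-- The lattice `Γ` of elements whose coordinates are Gaussian integers. -/
def lattice : Subgroup HeisenbergGroup where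
  carrier := {a | ∀ i, IsGaussian (a.coord i)}
  one_mem' := by
    intro i
    refine ⟨0, 0, ?_⟩
    fin_cases i <;> simp [HeisenbergGroup.coord_one]
  mul_mem' := by
    intro a b ha hb i
    obtain ⟨m0, n0, h0⟩ := ha 0
    obtain ⟨m1, n1, h1⟩ := ha 1
    obtain ⟨m2, n2, h2⟩ := ha 2
    obtain ⟨k0, l0, g0⟩ := hb 0
    obtain ⟨k1, l1, g1⟩ := hb 1
    obtain ⟨k2, l2, g2⟩ := hb 2
    fin_cases i
    · refine ⟨m0 + k0, n0 + l0, ?_⟩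
      simp [HeisenbergGroup.coord_mul, HeisenbergGroup.leftTranslation, h0, g0]
      ring
    · refine ⟨m1 + k1, n1 + l1, ?_⟩
      simp [HeisenbergGroup.coord_mul, HeisenbergGroup.leftTranslation, h1, g1]
      ring
    · refine ⟨m2 + k2 + (m0 * k1 - n0 * l1), n2 + l2 + (m0 * l1 + n0 * k1), ?_⟩
      simp [HeisenbergGroup.coord_mul, HeisenbergGroup.leftTranslation, h0, h2, g1, g2]
      linear_combination (n0 * l1 : ℂ) * Complex.I_sq
  inv_mem' := by
    intro a ha i
    obtain ⟨m0, n0, h0⟩ := ha 0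
    obtain ⟨m1, n1, h1⟩ := ha 1
    obtain ⟨m2, n2, h2⟩ := ha 2
    fin_cases i
    · refine ⟨-m0, -n0, ?_⟩
      simp [HeisenbergGroup.coord_inv, h0]
      ring
    · refine ⟨-m1, -n1, ?_⟩
      simp [HeisenbergGroup.coord_inv, h1]
      ring
    · refine ⟨-m2 + (m0 * m1 - n0 * n1), -n2 + (m0 * n1 + n0 * m1), ?_⟩
      simp [HeisenbergGroup.coord_inv, h0, h1, h2]
      linear_combination (n0 * n1 : ℂ) * Complex.I_sq

/-- The Iwasawa manifold `Γ \ G`, the set of cosets `Γ a`. -/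
def IwasawaManifold : Type := Quotient (QuotientGroup.rightRel lattice)

/-- The covering map from the Heisenberg group to the Iwasawa manifold. Geometric objects on the
Iwasawa manifold are written through this local diffeomorphism, as `Γ`-invariant objects in the
global coordinates of the group. -/
def proj (a : HeisenbergGroup) : IwasawaManifold :=
  Quotient.mk (QuotientGroup.rightRel lattice) a

/-! ### The invariant coframe and frame, and the metric -/

/-- Components of a tangent vector (or of a 1-form) in the invariant (co)frame. The 1-forms
written `e¹, …, e⁶` in mathematics have the indices `0, …, 5`. -/
abbrev Comp : Type := Fin 6 → ℝ

/-- The values `e¹(v), …, e⁶(v)` of the invariant 1-forms on a tangent vector `v` at `z`, where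
`e¹ + i e² = dζ₁`, `e³ + i e⁴ = dζ₂`, `e⁵ + i e⁶ = -dζ₃ + ζ₁ dζ₂`. -/
def coframe (z v : Coord) : Comp :=
  ![(v 0).re, (v 0).im, (v 1).re, (v 1).im, (-v 2 + z 0 * v 1).re, (-v 2 + z 0 * v 1).im]

/-- The tangent vector at `z` with given components in the dual frame. -/
def frame (z : Coord) (t : Comp) : Coord :=
  ![t 0 + t 1 * Complex.I, t 2 + t 3 * Complex.I,
    z 0 * (t 2 + t 3 * Complex.I) - (t 4 + t 5 * Complex.I)]

theorem coframe_frame (z : Coord) (t : Comp) : coframe z (frame z t) = t := by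
  ext i
  fin_cases i <;> simp [coframe, frame]

theorem frame_coframe (z v : Coord) : frame z (coframe z v) = v := by
  ext i
  fin_cases i <;> apply Complex.ext <;> simp [coframe, frame]

/-- The coframe is left-invariant; so it, the frame and the metric descend to `Γ \ G`. -/
theorem coframe_leftTranslation (a : HeisenbergGroup) (z v : Coord) :
    coframe (a.leftTranslation z) (fderiv ℝ a.leftTranslation z v) = coframe z v := by
  have h : HasFDerivAt a.leftTranslation
      (ContinuousLinearMap.pi ![ContinuousLinearMap.proj 0, ContinuousLinearMap.proj 1,
        ContinuousLinearMap.proj 2 + a.coord 0 • ContinuousLinearMap.proj 1] :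
          Coord →L[ℝ] Coord) z := by
    have hp : ∀ i : Fin 3, HasFDerivAt (fun w : Coord => w i)
        (ContinuousLinearMap.proj i : Coord →L[ℝ] ℂ) z := fun i => hasFDerivAt_apply i z
    rw [hasFDerivAt_pi']
    intro i
    fin_cases i
    · exact (hp 0).const_add (a.coord 0)
    · exact (hp 1).const_add (a.coord 1)
    · exact ((hp 2).const_add (a.coord 2)).add ((hp 1).const_mul (a.coord 0))
  rw [h.fderiv]
  ext i
  fin_cases i <;> simp [coframe, HeisenbergGroup.leftTranslation] <;> ring

/-- The vector field on the group, in coordinates, dual to the `i`-th coframe form. -/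
def e (i : Fin 6) : Coord → Coord := fun z => frame z (Pi.single i 1)

/-- The Riemannian metric `g = ∑ eⁱ ⊗ eⁱ`. -/
def metric (z v w : Coord) : ℝ := ∑ i, coframe z v i * coframe z w i

/-! ### The Levi-Civita connection -/

/-- The derivative at `z` of a function in the direction of a vector field. -/
def deriv₁ (X : Coord → Coord) (f : Coord → ℝ) (z : Coord) : ℝ := fderiv ℝ f z (X z)

/-- Right-hand side of the Koszul formula: the number `g(∇_X Y, Z)` at `z`. -/
def koszul (X Y Z : Coord → Coord) (z : Coord) : ℝ :=
  (1 / 2 : ℝ) *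
    (deriv₁ X (fun q => metric q (Y q) (Z q)) z
      + deriv₁ Y (fun q => metric q (X q) (Z q)) z
      - deriv₁ Z (fun q => metric q (X q) (Y q)) z
      + metric z (VectorField.lieBracket ℝ X Y z) (Z z)
      - metric z (VectorField.lieBracket ℝ X Z z) (Y z)
      - metric z (VectorField.lieBracket ℝ Y Z z) (X z))

/-- The Levi-Civita connection `∇_X Y` of the metric, expanded in the orthonormal frame. -/
def leviCivita (X Y : Coord → Coord) : Coord → Coord :=
  fun z => frame z (fun k => koszul X Y (e k) z)

/-! ### Invariant almost complex structures -/

/-- The invariant endomorphism field on the group with the constant matrix `J` in the frame: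
`J e_j = ∑ i, J i j • e_i`. -/
def endField (J : Matrix (Fin 6) (Fin 6) ℝ) (z v : Coord) : Coord := frame z (J *ᵥ coframe z v)

/-- The fundamental 2-form `ω(X, Y) = g(J X, Y)`. -/
def fundamental (J : Matrix (Fin 6) (Fin 6) ℝ) (z v w : Coord) : ℝ :=
  metric z (endField J z v) w

/-- The component matrix `ω(e_i, e_j) = g(J e_i, e_j)` of the fundamental 2-form. -/
def form (J : Matrix (Fin 6) (Fin 6) ℝ) : Matrix (Fin 6) (Fin 6) ℝ :=
  Matrix.of fun i j => (J *ᵥ Pi.single i 1) ⬝ᵥ Pi.single j 1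

/-- The Pfaffian of a skew matrix `w`: if `w` is the component matrix of a 2-form `ω`, then
`ω ∧ ω ∧ ω = 6 Pf(w) e¹²³⁴⁵⁶`. -/
def pfaffian (w : Matrix (Fin 6) (Fin 6) ℝ) : ℝ :=
  let q : Fin 6 → Fin 6 → Fin 6 → Fin 6 → ℝ :=
    fun a b c d => w a b * w c d - w a c * w b d + w a d * w b c
  w 0 1 * q 2 3 4 5 - w 0 2 * q 1 3 4 5 + w 0 3 * q 1 2 4 5
    - w 0 4 * q 1 2 3 5 + w 0 5 * q 1 2 3 4

/-- The space `𝒵` of invariant almost complex structures that are orthogonal and compatible with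
the orientation `e¹²³⁴⁵⁶`. -/
def acs : Set (Matrix (Fin 6) (Fin 6) ℝ) :=
  {J | J * J = -1 ∧ Jᵀ * J = 1 ∧ 0 < pfaffian (form J)}

/-! ### The Gray-Hervella decomposition -/

/-- Trilinear forms on a tangent space, in frame components. -/
abbrev Tensor3 : Type := Comp →ₗ[ℝ] Comp →ₗ[ℝ] Comp →ₗ[ℝ] ℝ

/-- `∇ω` at the point with coordinates `z`, evaluated on three vector fields:
`(∇_X ω)(Y, Z) = X(ω(Y, Z)) - ω(∇_X Y, Z) - ω(Y, ∇_X Z)`. -/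
def nablaEval (J : Matrix (Fin 6) (Fin 6) ℝ) (X Y Z : Coord → Coord) (z : Coord) : ℝ :=
  deriv₁ X (fun q => fundamental J q (Y q) (Z q)) z
    - fundamental J z (leviCivita X Y z) (Z z) - fundamental J z (Y z) (leviCivita X Z z)

/-- The tensor `∇ω` at the point with coordinates `z`, as the trilinear form with components
`(∇_{e_i} ω)(e_j, e_k)`. -/
def nablaForm (J : Matrix (Fin 6) (Fin 6) ℝ) (z : Coord) : Tensor3 :=
  ∑ i, ∑ j, ∑ k, nablaEval J (e i) (e j) (e k) z •
    (LinearMap.proj i : Comp →ₗ[ℝ] ℝ).smulRight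
      ((LinearMap.proj j : Comp →ₗ[ℝ] ℝ).smulRight (LinearMap.proj k : Comp →ₗ[ℝ] ℝ))

/-- The space `𝒲` of tensors with the symmetries of `∇ω`. -/
def W (J : Matrix (Fin 6) (Fin 6) ℝ) : Submodule ℝ Tensor3 where
  carrier := {T | (∀ x y z, T x y z = -T x z y) ∧ ∀ x y z, T x y z = -T x (J *ᵥ y) (J *ᵥ z)}
  zero_mem' := by constructor <;> simp
  add_mem' := by
    rintro S T ⟨hS1, hS2⟩ ⟨hT1, hT2⟩
    refine ⟨fun x y z => ?_, fun x y z => ?_⟩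
    · have h := hS1 x y z
      have h' := hT1 x y z
      simp only [LinearMap.add_apply]
      linarith
    · have h := hS2 x y z
      have h' := hT2 x y z
      simp only [LinearMap.add_apply]
      linarith
  smul_mem' := by
    rintro c T ⟨hT1, hT2⟩
    refine ⟨fun x y z => ?_, fun x y z => ?_⟩
    · simp only [LinearMap.smul_apply, smul_eq_mul]
      rw [hT1 x y z, mul_neg]
    · simp only [LinearMap.smul_apply, smul_eq_mul]
      rw [hT2 x y z, mul_neg]

/-- `𝒲₁`: the totally skew tensors in `𝒲`. -/
def W₁ (J : Matrix (Fin 6) (Fin 6) ℝ) : Submodule ℝ Tensor3 :=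
  W J ⊓
  { carrier := {T | ∀ x z, T x x z = 0}
    zero_mem' := by simp
    add_mem' := by
      intro S T hS hT x z
      have h := hS x z
      have h' := hT x z
      simp only [LinearMap.add_apply]
      linarith
    smul_mem' := by
      intro c T hT x z
      have h := hT x z
      simp [h] }

/-- `𝒲₂`: the tensors in `𝒲` with vanishing cyclic sum. -/
def W₂ (J : Matrix (Fin 6) (Fin 6) ℝ) : Submodule ℝ Tensor3 :=
  W J ⊓
  { carrier := {T | ∀ x y z, T x y z + T y z x + T z x y = 0}
    zero_mem' := by simp
    add_mem' := by
      intro S T hS hT x y z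
      have h := hS x y z
      have h' := hT x y z
      simp only [LinearMap.add_apply]
      linarith
    smul_mem' := by
      intro c T hT x y z
      have h := hT x y z
      simp only [LinearMap.smul_apply, smul_eq_mul]
      rw [← mul_add, ← mul_add, h, mul_zero] }

/-- `𝒲₃`: the tensors in `𝒲` with `T(x, y, z) = T(Jx, Jy, z)` and vanishing trace
`∑ T(e_i, e_i, z)`. -/
def W₃ (J : Matrix (Fin 6) (Fin 6) ℝ) : Submodule ℝ Tensor3 :=
  W J ⊓
  { carrier := {T | (∀ x y z, T x y z = T (J *ᵥ x) (J *ᵥ y) z) ∧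
      ∀ z, ∑ i, T (Pi.single i 1) (Pi.single i 1) z = 0}
    zero_mem' := by constructor <;> simp
    add_mem' := by
      rintro S T ⟨hS1, hS2⟩ ⟨hT1, hT2⟩
      refine ⟨fun x y z => ?_, fun z => ?_⟩
      · have h := hS1 x y z
        have h' := hT1 x y z
        simp only [LinearMap.add_apply]
        linarith
      · have h := hS2 z
        have h' := hT2 z
        simp only [LinearMap.add_apply, Finset.sum_add_distrib]
        linarith
    smul_mem' := by
      rintro c T ⟨hT1, hT2⟩
      refine ⟨fun x y z => ?_, fun z => ?_⟩
      · simp only [LinearMap.smul_apply, smul_eq_mul]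
        rw [hT1 x y z]
      · simp only [LinearMap.smul_apply, smul_eq_mul]
        rw [← Finset.mul_sum, hT2 z, mul_zero] }

/-- `𝒲₄`: the tensors determined by a 1-form `θ`, namely
`T(x, y, z) = ⟨x, y⟩ θ(z) - ⟨x, z⟩ θ(y) - ⟨x, Jy⟩ θ(Jz) + ⟨x, Jz⟩ θ(Jy)`; contraction gives
`∑ T(e_i, e_i, z) = 2 (n - 1) θ(z)` with `n = 3`. -/
def W₄ (J : Matrix (Fin 6) (Fin 6) ℝ) : Submodule ℝ Tensor3 :=
  W J ⊓
  { carrier := {T | ∃ θ : Comp →ₗ[ℝ] ℝ, ∀ x y z, T x y z =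
      (x ⬝ᵥ y) * θ z - (x ⬝ᵥ z) * θ y
        - (x ⬝ᵥ (J *ᵥ y)) * θ (J *ᵥ z) + (x ⬝ᵥ (J *ᵥ z)) * θ (J *ᵥ y)}
    zero_mem' := ⟨0, by simp⟩
    add_mem' := by
      rintro S T ⟨θ, hS⟩ ⟨η, hT⟩
      refine ⟨θ + η, fun x y z => ?_⟩
      simp only [LinearMap.add_apply]
      rw [hS x y z, hT x y z]
      ring
    smul_mem' := by
      rintro c T ⟨θ, hT⟩
      refine ⟨c • θ, fun x y z => ?_⟩
      simp only [LinearMap.smul_apply, smul_eq_mul]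
      rw [hT x y z]
      ring }

/-- The set of all `J` in `𝒵` for which, at every point of the Iwasawa manifold, `∇ω` lies in the
space of tensors that `U` assigns to `J`. -/
def grayHervellaClass (U : Matrix (Fin 6) (Fin 6) ℝ → Submodule ℝ Tensor3) :
    Set (Matrix (Fin 6) (Fin 6) ℝ) :=
  {J | J ∈ acs ∧ ∀ m : IwasawaManifold, ∀ a : HeisenbergGroup, proj a = m →
    nablaForm J a.coord ∈ U J}

/-- The class `𝒵₂₃₄`. -/
def Z₂₃₄ : Set (Matrix (Fin 6) (Fin 6) ℝ) := grayHervellaClass fun J => W₂ J ⊔ W₃ J ⊔ W₄ J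

/-- The class `𝒵₁₃₄`. -/
def Z₁₃₄ : Set (Matrix (Fin 6) (Fin 6) ℝ) := grayHervellaClass fun J => W₁ J ⊔ W₃ J ⊔ W₄ J

/-- The class `𝒵₁₂₄`. -/
def Z₁₂₄ : Set (Matrix (Fin 6) (Fin 6) ℝ) := grayHervellaClass fun J => W₁ J ⊔ W₂ J ⊔ W₄ J

/-- The class `𝒵₁₂₃`. -/
def Z₁₂₃ : Set (Matrix (Fin 6) (Fin 6) ℝ) := grayHervellaClass fun J => W₁ J ⊔ W₂ J ⊔ W₃ J

/-- The class `𝒵₂` of almost Kähler structures. -/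
def Z₂ : Set (Matrix (Fin 6) (Fin 6) ℝ) := grayHervellaClass W₂

/-! ### Points of complex projective 3-space, faces and edges -/

/-- The `i`-eigenspace of `J` on complex 1-forms, where `(J α)(X) = α(J X)`. -/
def iEigenspace (J : Matrix (Fin 6) (Fin 6) ℝ) : Set (Fin 6 → ℂ) :=
  {α | α ᵥ* J.map Complex.ofReal = Complex.I • α}

/-- The element `u ∧ v` of `Λ² ℂ⁴`, identified with a complex 1-form by
`2 v⁰¹ = e¹ + i e²`, `2 v²³ = e¹ - i e²`, `2 v⁰² = e³ + i e⁴`, `2 v³¹ = e³ - i e⁴`,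
`2 v⁰³ = e⁵ + i e⁶`, `2 v¹² = e⁵ - i e⁶`. -/
def kleinWedge (u v : Fin 4 → ℂ) : Fin 6 → ℂ :=
  let p : Fin 4 → Fin 4 → ℂ := fun i j => u i * v j - u j * v i
  ![(p 0 1 + p 2 3) / 2, Complex.I * (p 0 1 - p 2 3) / 2,
    (p 0 2 + p 3 1) / 2, Complex.I * (p 0 2 - p 3 1) / 2,
    (p 0 3 + p 1 2) / 2, Complex.I * (p 0 3 - p 1 2) / 2]

/-- The totally isotropic space `V_u = {u ∧ v : v ∈ ℂ⁴}` of complex 1-forms. -/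
def isotropicSpace (u : Fin 4 → ℂ) : Set (Fin 6 → ℂ) := Set.range (kleinWedge u)

/-- The face opposite to the vertex `i`: the projective plane `u_i = 0`. -/
def face (i : Fin 4) : Set (Matrix (Fin 6) (Fin 6) ℝ) :=
  {J | J ∈ acs ∧ ∃ u : Fin 4 → ℂ, u ≠ 0 ∧ u i = 0 ∧ iEigenspace J = isotropicSpace u}

/-- The edge through the vertices `i` and `j`: the projective line on which all other coordinates
vanish. -/
def edge (i j : Fin 4) : Set (Matrix (Fin 6) (Fin 6) ℝ) :=
  {J | J ∈ acs ∧ ∃ u : Fin 4 → ℂ, u ≠ 0 ∧ (∀ k, k ≠ i → k ≠ j → u k = 0) ∧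
    iEigenspace J = isotropicSpace u}

/-! ### Vertices and the 3-sphere, through fundamental forms -/

/-- The component matrix of the 2-form `a ∧ b`. -/
def wedge (a b : Comp) : Matrix (Fin 6) (Fin 6) ℝ := Matrix.of fun i j => a i * b j - a j * b i

/-- The 2-form `eⁱ ∧ eʲ` (with indices from `0`). -/
def ee (i j : Fin 6) : Matrix (Fin 6) (Fin 6) ℝ := wedge (Pi.single i 1) (Pi.single j 1)

/-- The fundamental forms `ω₀, ω₁, ω₂, ω₃` of the vertices of the tetrahedron. -/
def vertexForm : Fin 4 → Matrix (Fin 6) (Fin 6) ℝ :=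
  ![ee 0 1 + ee 2 3 + ee 4 5, ee 0 1 - ee 2 3 - ee 4 5,
    -ee 0 1 + ee 2 3 - ee 4 5, -ee 0 1 - ee 2 3 + ee 4 5]

/-- The set whose only point is the vertex `i`, the structure with fundamental form `ω_i`. -/
def vertexSet (i : Fin 4) : Set (Matrix (Fin 6) (Fin 6) ℝ) := {J | J ∈ acs ∧ form J = vertexForm i}

/-- The 1-form `f^j = P e^j` (`1 ≤ j ≤ 4`, with indices from `0`) in the span of `e¹, …, e⁴`. -/
def rotated (P : Matrix (Fin 4) (Fin 4) ℝ) (j : Fin 4) : Comp :=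
  ![P 0 j, P 1 j, P 2 j, P 3 j, 0, 0]

/-- The 2-form
`ω(P; a, b) = e⁵ ∧ (a e⁶ + b f¹) - f² ∧ (a f¹ - b e⁶) + f³ ∧ f⁴`, where `f^j = P e^j`. -/
def paramForm (P : Matrix (Fin 4) (Fin 4) ℝ) (a b : ℝ) : Matrix (Fin 6) (Fin 6) ℝ :=
  wedge (Pi.single 4 1) (a • Pi.single 5 1 + b • rotated P 0)
    - wedge (rotated P 1) (a • rotated P 0 - b • Pi.single 5 1)
    + wedge (rotated P 2) (rotated P 3)

/-- The first diagonal entry of the action `P₊` of `P` on self-dual 2-forms in the basis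
`e¹² + e³⁴, e¹³ + e⁴², e¹⁴ + e²³`: the coefficient of `e¹² + e³⁴` in `P (e¹² + e³⁴)`. A 2-form with
component matrix `σ` has the inner product `(1/2) ∑ σ_ij τ_ij` with `τ = e¹² + e³⁴`, and `τ` has
squared norm `2`. -/
def selfDualEntry (P : Matrix (Fin 4) (Fin 4) ℝ) : ℝ :=
  (1 / 4 : ℝ) * ∑ i, ∑ j,
    (wedge (rotated P 0) (rotated P 1) + wedge (rotated P 2) (rotated P 3)) i j *
      (ee 0 1 + ee 2 3) i j

/-- The set `𝒮` of structures with fundamental form `ω(P; 0, 1)`, where `P ∈ SO(4)` is such that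
`P₊` has first diagonal entry `1`. -/
def sphere : Set (Matrix (Fin 6) (Fin 6) ℝ) :=
  {J | J ∈ acs ∧ ∃ P ∈ Matrix.specialOrthogonalGroup (Fin 4) ℝ,
    selfDualEntry P = 1 ∧ form J = paramForm P 0 1}

end Iwasawa

end

noncomputable section

namespace Iwasawa

open Matrix

/-! The bijection is the Klein correspondence. The space `V_u` is maximal isotropic in `Λ² ℂ⁴`, and
`|u|² J` has entries that are real-linear in the hermitian matrix `(u_i ū_j)`; see `kleinMatrix`.
Two polynomial identities, `kleinWedge_vecMul_kleinMatrix` and `kleinWedge_contract`, identify its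
eigenspace. The entries of `J` determine `(u_i ū_j)` up to scale, hence `[u]`. Conversely, for `J`
in `𝒵` the relation `J² = -1` and the equality of each entry, up to sign, with the complementary 4 ×
4 Pfaffian force the candidate for `4 u_i ū_j / |u|²` to have rank one, so a nonzero column of it
serves as `u` (`exists_structureOf_eq_skewMatrix`).

The map `T ↦ T(J·, J·, ·)` is an involution of `𝒲` with `-1`-eigenspace `𝒲₁ ⊕ 𝒲₂` and
`+1`-eigenspace `𝒲₃ ⊕ 𝒲₄`. The cyclic sum separates `𝒲₁` from `𝒲₂`, and the trace over the first two
slots separates `𝒲₄` from `𝒲₃`. Each class thus becomes a concrete vanishing condition on one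
eigencomponent of `∇ω` or on its trace.

In the invariant frame the metric is constant, so `∇ω` has constant coefficients and is given by the
trilinear form `koszulForm`. Extended to complex vectors, this form restricted to `V_u × V_u × V_u`
gives the `-1`-part of `∇ω`, and restricted to `V̄_u × V_u × V_u` it gives the `+1`-part
(`antiPart_nablaForm`, `symPart_nablaForm`). In the null coordinates of `Λ² ℂ⁴` these restrictions
are short polynomials in `u`: the cyclic sum is a multiple of `u₃²`, which gives `𝒵₂₃₄`; the values
at `(α, α, β)` vanish only on the vertex and the edge, which gives `𝒵₁₃₄`; the trace is a multiple
of `u₀ ū₃`, which gives `𝒵₁₂₃`; for `𝒵₁₂₄`, evaluation on vectors where every `𝒲₄` tensor vanishes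
eliminates the unknown 1-form.

The cyclic sum of `∇ω` is `dω` up to normalisation, so `𝒵₂` is a system of linear equations in `J`.
In coordinates it reads `u₃ = 0`, `|u₀|² = |u₁|² + |u₂|²`, and the normalisation `u₀ = 1` exhibits a
3-sphere. The same sphere describes `𝒮`, because the condition on `P` says that `P` fixes `e¹² +
e³⁴`, after which the fundamental form depends on the unit vector `f¹` alone. -/

/-- The number `g([x, y], z)`, extended to any commutative ring of scalars. -/
def bracketForm {R : Type*} [CommRing R] (x y z : Fin 6 → R) : R :=
  -(x 0 * y 2 - x 2 * y 0 - x 1 * y 3 + x 3 * y 1) * z 4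
    - (x 0 * y 3 - x 3 * y 0 + x 1 * y 2 - x 2 * y 1) * z 5

/-- The number `2 g(∇_x y, z)` for invariant vector fields, extended to any commutative ring of
scalars. -/
def koszulForm {R : Type*} [CommRing R] (x y z : Fin 6 → R) : R :=
  bracketForm x y z - bracketForm x z y - bracketForm y z x

section koszulForm
variable {R : Type*} [CommRing R] (x y z w : Fin 6 → R) (c : R)

theorem koszulForm_add_left : koszulForm (x + w) y z = koszulForm x y z + koszulForm w y z := by
  simp only [koszulForm, bracketForm, Pi.add_apply]; ring
theorem koszulForm_add_mid : koszulForm x (y + w) z = koszulForm x y z + koszulForm x w z := by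
  simp only [koszulForm, bracketForm, Pi.add_apply]; ring
theorem koszulForm_add_right : koszulForm x y (z + w) = koszulForm x y z + koszulForm x y w := by
  simp only [koszulForm, bracketForm, Pi.add_apply]; ring
theorem koszulForm_smul_left : koszulForm (c • x) y z = c * koszulForm x y z := by
  simp only [koszulForm, bracketForm, Pi.smul_apply, smul_eq_mul]; ring
theorem koszulForm_smul_mid : koszulForm x (c • y) z = c * koszulForm x y z := by
  simp only [koszulForm, bracketForm, Pi.smul_apply, smul_eq_mul]; ring
theorem koszulForm_smul_right : koszulForm x y (c • z) = c * koszulForm x y z := by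
  simp only [koszulForm, bracketForm, Pi.smul_apply, smul_eq_mul]; ring
theorem koszulForm_swap : koszulForm x y z = -koszulForm x z y := by
  simp only [koszulForm, bracketForm]; ring

end koszulForm

/-! ### The Levi-Civita connection and `∇ω` in the invariant frame -/

theorem metric_eq (z v w : Coord) : metric z v w = coframe z v ⬝ᵥ coframe z w := rfl

theorem metric_frame (z : Coord) (s t : Comp) : metric z (frame z s) (frame z t) = s ⬝ᵥ t := by
  rw [metric_eq, coframe_frame, coframe_frame]

theorem metric_e (z : Coord) (i j : Fin 6) :
    metric z (e i z) (e j z) = (Pi.single i 1 : Comp) ⬝ᵥ Pi.single j 1 :=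
  metric_frame _ _ _

theorem fundamental_frame (J : Matrix (Fin 6) (Fin 6) ℝ) (z : Coord) (s t : Comp) :
    fundamental J z (frame z s) (frame z t) = (J *ᵥ s) ⬝ᵥ t := by
  rw [fundamental, endField, metric_eq, coframe_frame, coframe_frame, coframe_frame]

theorem hasFDerivAt_e (i : Fin 6) (z : Coord) :
    HasFDerivAt (e i)
      (ContinuousLinearMap.pi ![0, 0,
        ((Pi.single i 1 : Comp) 2 + (Pi.single i 1 : Comp) 3 * Complex.I : ℂ) •
          ContinuousLinearMap.proj 0] : Coord →L[ℝ] Coord) z := by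
  rw [hasFDerivAt_pi']
  intro k
  fin_cases k
  · exact hasFDerivAt_const _ _
  · exact hasFDerivAt_const _ _
  · have hp : HasFDerivAt (fun w : Coord => w 0)
        (ContinuousLinearMap.proj 0 : Coord →L[ℝ] ℂ) z := hasFDerivAt_apply 0 z
    have := (hp.const_mul ((Pi.single i 1 : Comp) 2 + (Pi.single i 1 : Comp) 3 * Complex.I
      : ℂ)).sub_const
      ((Pi.single i 1 : Comp) 4 + (Pi.single i 1 : Comp) 5 * Complex.I : ℂ)
    refine this.congr_of_eventuallyEq (Filter.Eventually.of_forall fun w => ?_)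
    simp [e, frame, mul_comm]

theorem metric_lieBracket_e (i j k : Fin 6) (z : Coord) :
    metric z (VectorField.lieBracket ℝ (e i) (e j) z) (e k z) =
      bracketForm (Pi.single i 1 : Comp) (Pi.single j 1) (Pi.single k 1) := by
  rw [VectorField.lieBracket, (hasFDerivAt_e j z).fderiv, (hasFDerivAt_e i z).fderiv, metric_eq,
    e, e, e, coframe_frame]
  generalize (Pi.single i 1 : Comp) = s
  generalize (Pi.single j 1 : Comp) = t
  generalize (Pi.single k 1 : Comp) = r
  simp [coframe, frame, dotProduct, Fin.sum_univ_six, bracketForm]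
  ring

/-- Inner products of frame fields are constant, so the three derivative terms of the Koszul formula
vanish and only brackets remain. -/
theorem koszul_e (i j k : Fin 6) (z : Coord) :
    koszul (e i) (e j) (e k) z =
      koszulForm (Pi.single i 1 : Comp) (Pi.single j 1) (Pi.single k 1) / 2 := by
  simp only [koszul, deriv₁, metric_e, metric_lieBracket_e, koszulForm]
  simp
  ring

theorem koszulForm_eq_sum (x y z : Comp) :
    koszulForm x y z = ∑ k, koszulForm x y (Pi.single k 1) * z k := by
  simp [koszulForm, bracketForm, Fin.sum_univ_six, Pi.single_apply]
  ring

theorem nablaEval_e {J : Matrix (Fin 6) (Fin 6) ℝ} (hJ : Jᵀ = -J) (i j k : Fin 6) (z : Coord) :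
    nablaEval J (e i) (e j) (e k) z =
      (koszulForm (Pi.single i 1 : Comp) (Pi.single j 1) (J *ᵥ Pi.single k 1) +
        koszulForm (Pi.single i 1 : Comp) (J *ᵥ Pi.single j 1) (Pi.single k 1)) / 2 := by
  have key : ∀ x y w : Comp, w ⬝ᵥ (fun l => koszulForm x y (Pi.single l 1) / 2) =
      koszulForm x y w / 2 := by
    intro x y w
    rw [koszulForm_eq_sum x y w, dotProduct, Finset.sum_div]
    exact Finset.sum_congr rfl fun l _ => by ring
  have h1 : (fun q => fundamental J q (e j q) (e k q)) =
      fun _ => (J *ᵥ Pi.single j 1) ⬝ᵥ (Pi.single k 1 : Comp) := by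
    funext q; exact fundamental_frame _ _ _ _
  have h2 : ∀ s t : Comp, (J *ᵥ s) ⬝ᵥ t = - ((J *ᵥ t) ⬝ᵥ s) := by
    intro s t
    rw [dotProduct_comm, dotProduct_mulVec, ← mulVec_transpose, hJ, neg_mulVec, neg_dotProduct]
  have h3 : fundamental J z (leviCivita (e i) (e j) z) (e k z) =
      -(koszulForm (Pi.single i 1 : Comp) (Pi.single j 1) (J *ᵥ Pi.single k 1) / 2) := by
    simp only [leviCivita, koszul_e]
    rw [e, fundamental_frame, h2, key]
  have h4 : fundamental J z (e j z) (leviCivita (e i) (e k) z) =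
      koszulForm (Pi.single i 1 : Comp) (Pi.single k 1) (J *ᵥ Pi.single j 1) / 2 := by
    simp only [leviCivita, koszul_e]
    rw [e, fundamental_frame, key]
  rw [nablaEval, deriv₁, h1, h3, h4, koszulForm_swap _ (Pi.single k 1)]
  simp
  ring

/-- Both sides are trilinear, so the frame computation `nablaEval_e` suffices. There, skewness of
`J` moves it from the covariant derivative onto the other argument. -/
theorem nablaForm_apply {J : Matrix (Fin 6) (Fin 6) ℝ} (hJ : Jᵀ = -J) (p : Coord) (x y z : Comp) :
    nablaForm J p x y z = (koszulForm x y (J *ᵥ z) + koszulForm x (J *ᵥ y) z) / 2 := by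
  have ex : ∀ (f : Comp →ₗ[ℝ] ℝ) (v : Comp), f v = ∑ i, v i * f (Pi.single i 1) := fun f v => by
    rw [f.pi_apply_eq_sum_univ v]
    refine Finset.sum_congr rfl fun i _ => ?_
    rw [smul_eq_mul]
    congr 2
    funext j
    simp [Pi.single_apply, eq_comm]
  let F : Comp → Comp → Comp → ℝ :=
    fun x y z => (koszulForm x y (J *ᵥ z) + koszulForm x (J *ᵥ y) z) / 2
  have l1 : ∀ y z, IsLinearMap ℝ fun x => F x y z := fun y z =>
    ⟨fun a b => by simp only [F, koszulForm_add_left]; ring,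
      fun c a => by simp only [F, koszulForm_smul_left, smul_eq_mul]; ring⟩
  have l2 : ∀ x z, IsLinearMap ℝ fun y => F x y z := fun x z =>
    ⟨fun a b => by simp only [F, koszulForm_add_mid, mulVec_add]; ring,
      fun c a => by simp only [F, koszulForm_smul_mid, mulVec_smul, smul_eq_mul]; ring⟩
  have l3 : ∀ x y, IsLinearMap ℝ fun z => F x y z := fun x y =>
    ⟨fun a b => by simp only [F, koszulForm_add_right, mulVec_add]; ring,
      fun c a => by simp only [F, koszulForm_smul_right, mulVec_smul, smul_eq_mul]; ring⟩
  have s1 := ex ((l1 y z).mk' _) x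
  have s2 := fun i => ex ((l2 (Pi.single i 1) z).mk' _) y
  have s3 := fun i j => ex ((l3 (Pi.single i 1) (Pi.single j 1)).mk' _) z
  simp only [IsLinearMap.mk'_apply] at s1 s2 s3
  change _ = F x y z
  rw [s1]
  simp only [nablaForm, LinearMap.sum_apply, LinearMap.smul_apply, LinearMap.smulRight_apply,
    LinearMap.proj_apply, smul_eq_mul, nablaEval_e hJ]
  refine Finset.sum_congr rfl fun i _ => ?_
  rw [s2, Finset.mul_sum]
  refine Finset.sum_congr rfl fun j _ => ?_
  rw [s3, Finset.mul_sum, Finset.mul_sum]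
  refine Finset.sum_congr rfl fun k _ => ?_
  simp only [F]
  ring

/-! ### Gray–Hervella algebra: the involution `T ↦ T(J·, J·, ·)`, cyclic sums and traces -/

section GrayHervella

variable {J : Matrix (Fin 6) (Fin 6) ℝ} {T : Tensor3}

theorem mulVec_mulVec_of_sq (hJ : J * J = -1) (x : Comp) : J *ᵥ (J *ᵥ x) = -x := by
  rw [mulVec_mulVec, hJ, neg_mulVec, one_mulVec]

theorem W_swap (hT : T ∈ W J) (x y z : Comp) : T x y z = -T x z y := hT.1 x y z

theorem W_apply_J_J (hT : T ∈ W J) (x y z : Comp) : T x (J *ᵥ y) (J *ᵥ z) = -T x y z := by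
  rw [hT.2 x y z, neg_neg]

theorem W_apply_J (hJ : J * J = -1) (hT : T ∈ W J) (x y z : Comp) :
    T x (J *ᵥ y) z = T x y (J *ᵥ z) := by
  rw [hT.2 x y (J *ᵥ z), mulVec_mulVec_of_sq hJ, map_neg, neg_neg]

/-- The tensors with `T(Jx, Jy, z) = -T(x, y, z)`. -/
def IsAnti (J : Matrix (Fin 6) (Fin 6) ℝ) (T : Tensor3) : Prop :=
  ∀ x y z, T (J *ᵥ x) (J *ᵥ y) z = -T x y z

/-- The tensors with `T(Jx, Jy, z) = T(x, y, z)`. -/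
def IsSym (J : Matrix (Fin 6) (Fin 6) ℝ) (T : Tensor3) : Prop :=
  ∀ x y z, T (J *ᵥ x) (J *ᵥ y) z = T x y z

theorem W₁_swap_left (hT : T ∈ W₁ J) (x y z : Comp) : T x y z = -T y x z := by
  have h := hT.2 (x + y) z
  have hx := hT.2 x z
  have hy := hT.2 y z
  simp only [map_add, LinearMap.add_apply] at h
  linarith

/-- Applying `J` in the last two slots changes the sign on all of `𝒲`; total skewness carries this
to the first two. -/
theorem isAnti_of_mem_W₁ (hT : T ∈ W₁ J) : IsAnti J T := by
  intro x y z
  have h1 := W_apply_J_J hT.1 z x y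
  have h2 := W₁_swap_left hT z (J *ᵥ x) (J *ᵥ y)
  have h3 := W_swap hT.1 (J *ᵥ x) z (J *ᵥ y)
  have h4 := W₁_swap_left hT z x y
  have h5 := W_swap hT.1 x z y
  linarith

theorem isAnti_of_mem_W₂ (hJ : J * J = -1) (hT : T ∈ W₂ J) : IsAnti J T := by
  intro x y z
  have hc := hT.2
  -- With the symmetries of `𝒲`, the combination `c1 - c2 + c3 + c4` of these cyclic sums reduces to
  -- `2 T(x, y, z) + 2 T(Jx, Jy, z) = 0`.
  have c1 := hc x y z
  have c2 := hc x (J *ᵥ y) (J *ᵥ z)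
  have c3 := hc (J *ᵥ x) (J *ᵥ y) z
  have c4 := hc (J *ᵥ x) y (J *ᵥ z)
  have a1 := W_apply_J_J hT.1 x y z
  have a2 := W_apply_J hJ hT.1 (J *ᵥ x) y z
  have a3 := W_apply_J hJ hT.1 (J *ᵥ y) z x
  have a4 := W_apply_J_J hT.1 y z x
  have a5 := W_apply_J hJ hT.1 (J *ᵥ z) x y
  have a6 := W_apply_J_J hT.1 z x y
  linarith

theorem isSym_of_mem_W₃ (hT : T ∈ W₃ J) : IsSym J T := fun x y z => (hT.2.1 x y z).symm

theorem dotProduct_mulVec_of_skew (hJt : Jᵀ = -J) (x y : Comp) :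
    x ⬝ᵥ (J *ᵥ y) = -((J *ᵥ x) ⬝ᵥ y) := by
  rw [dotProduct_mulVec, ← mulVec_transpose, hJt, neg_mulVec, neg_dotProduct]

theorem isSym_of_mem_W₄ (hJ : J * J = -1) (hJt : Jᵀ = -J) (hT : T ∈ W₄ J) : IsSym J T := by
  obtain ⟨θ, h⟩ := hT.2
  intro x y z
  rw [h, h]
  simp only [dotProduct_mulVec_of_skew hJt, mulVec_mulVec_of_sq hJ, neg_dotProduct, dotProduct_neg,
    map_neg]
  ring

theorem isAnti_of_mem_W₁_sup_W₂ (hJ : J * J = -1) (hT : T ∈ W₁ J ⊔ W₂ J) : IsAnti J T := by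
  obtain ⟨S, hS, R, hR, rfl⟩ := Submodule.mem_sup.1 hT
  intro x y z
  have h1 := isAnti_of_mem_W₁ hS x y z
  have h2 := isAnti_of_mem_W₂ hJ hR x y z
  simp only [LinearMap.add_apply]
  linarith

theorem isSym_of_mem_W₃_sup_W₄ (hJ : J * J = -1) (hJt : Jᵀ = -J) (hT : T ∈ W₃ J ⊔ W₄ J) :
    IsSym J T := by
  obtain ⟨S, hS, R, hR, rfl⟩ := Submodule.mem_sup.1 hT
  intro x y z
  have h1 := isSym_of_mem_W₃ hS x y z
  have h2 := isSym_of_mem_W₄ hJ hJt hR x y z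
  simp only [LinearMap.add_apply]
  linarith

/-- The tensor `T(Jx, Jy, z)`. -/
def twist (J : Matrix (Fin 6) (Fin 6) ℝ) (T : Tensor3) : Tensor3 :=
  T.compl₁₂ J.mulVecLin J.mulVecLin

theorem twist_apply (x y z : Comp) : twist J T x y z = T (J *ᵥ x) (J *ᵥ y) z := rfl

/-- The component of a tensor in `𝒲` on which `IsAnti` holds. -/
def antiPart (J : Matrix (Fin 6) (Fin 6) ℝ) (T : Tensor3) : Tensor3 :=
    (1 / 2 : ℝ) • (T + (-1 : ℝ) • twist J T)

/-- The component of a tensor in `𝒲` on which `IsSym` holds. -/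
def symPart (J : Matrix (Fin 6) (Fin 6) ℝ) (T : Tensor3) : Tensor3 := (1 / 2 : ℝ) • (T + twist J T)

theorem antiPart_apply (x y z : Comp) :
    antiPart J T x y z = (T x y z - T (J *ᵥ x) (J *ᵥ y) z) / 2 := by
  simp [antiPart, twist_apply]; ring

theorem symPart_apply (x y z : Comp) :
    symPart J T x y z = (T x y z + T (J *ᵥ x) (J *ᵥ y) z) / 2 := by
  simp [symPart, twist_apply]; ring

theorem antiPart_add_symPart : antiPart J T + symPart J T = T := by
  refine LinearMap.ext fun x => LinearMap.ext fun y => LinearMap.ext fun z => ?_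
  simp only [LinearMap.add_apply, antiPart_apply, symPart_apply]
  ring

theorem twist_mem_W (hJ : J * J = -1) (hT : T ∈ W J) : twist J T ∈ W J := by
  refine ⟨fun x y z => ?_, fun x y z => ?_⟩
  · rw [twist_apply, twist_apply, W_apply_J hJ hT, W_swap hT]
  · rw [twist_apply, twist_apply, W_apply_J_J hT, neg_neg]

theorem antiPart_mem_W (hJ : J * J = -1) (hT : T ∈ W J) : antiPart J T ∈ W J :=
  (W J).smul_mem _ ((W J).add_mem hT ((W J).smul_mem _ (twist_mem_W hJ hT)))

theorem symPart_mem_W (hJ : J * J = -1) (hT : T ∈ W J) : symPart J T ∈ W J :=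
  (W J).smul_mem _ ((W J).add_mem hT (twist_mem_W hJ hT))

theorem isAnti_antiPart (hJ : J * J = -1) : IsAnti J (antiPart J T) := by
  intro x y z
  simp only [antiPart_apply, mulVec_mulVec_of_sq hJ, map_neg, LinearMap.neg_apply]
  ring

theorem isSym_symPart (hJ : J * J = -1) : IsSym J (symPart J T) := by
  intro x y z
  simp only [symPart_apply, mulVec_mulVec_of_sq hJ, map_neg, LinearMap.neg_apply]
  ring

/-- The cyclic sum of a tensor. -/
def cyclicSum (T : Tensor3) : Tensor3 :=
  T + LinearMap.flip (LinearMap.lflip.comp T) + LinearMap.lflip.comp (LinearMap.flip T)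

theorem cyclicSum_apply (x y z : Comp) :
    cyclicSum T x y z = T x y z + T y z x + T z x y := rfl

/-- A third of the cyclic sum is the skew part. It lies in `𝒲` because of the sign rule under `J`,
and subtracting it leaves a tensor with cyclic sum zero. -/
theorem mem_W₁_sup_W₂ (hJ : J * J = -1) (hT : T ∈ W J) (hA : IsAnti J T) : T ∈ W₁ J ⊔ W₂ J := by
  have hC : cyclicSum T ∈ W₁ J := by
    refine ⟨⟨fun x y z => ?_, fun x y z => ?_⟩, fun x z => ?_⟩
    · simp only [cyclicSum_apply]
      linarith [W_swap hT x y z, W_swap hT y z x, W_swap hT z x y]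
    · simp only [cyclicSum_apply]
      linarith [W_apply_J_J hT x y z, hA y z x, hA z x y, W_apply_J hJ hT (J *ᵥ z) x y]
    · simp only [cyclicSum_apply]
      linarith [W_swap hT x x z, W_swap hT z x x]
  refine Submodule.mem_sup.2 ⟨(1 / 3 : ℝ) • cyclicSum T, (W₁ J).smul_mem _ hC,
    T + (-(1 / 3) : ℝ) • cyclicSum T,
    ⟨(W J).add_mem hT ((W J).smul_mem _ hC.1), fun x y z => ?_⟩, ?_⟩
  · simp only [LinearMap.add_apply, LinearMap.smul_apply, cyclicSum_apply, smul_eq_mul]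
    ring
  · refine LinearMap.ext fun x => LinearMap.ext fun y => LinearMap.ext fun z => ?_
    simp only [LinearMap.add_apply, LinearMap.smul_apply, smul_eq_mul]
    ring

/-- The trace `∑ T(e_i, e_i, z)`. -/
def trace₁₂ (T : Tensor3) : Comp →ₗ[ℝ] ℝ := ∑ i, T (Pi.single i 1) (Pi.single i 1)

theorem trace₁₂_apply (z : Comp) : trace₁₂ T z = ∑ i, T (Pi.single i 1) (Pi.single i 1) z := by
  simp [trace₁₂]

theorem trace₁₂_add (S T : Tensor3) (z : Comp) : trace₁₂ (S + T) z = trace₁₂ S z + trace₁₂ T z := by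
  simp [trace₁₂_apply, Finset.sum_add_distrib]

theorem trace₁₂_smul (c : ℝ) (T : Tensor3) (z : Comp) : trace₁₂ (c • T) z = c * trace₁₂ T z := by
  simp [trace₁₂_apply, Finset.mul_sum]

/-- The trace does not depend on the orthonormal basis, and `J` carries the standard one to another.
It follows that tensors in the `-1`-eigenspace are traceless. -/
theorem trace₁₂_twist (hJ : J * J = -1) (hJt : Jᵀ = -J) (z : Comp) :
    trace₁₂ (twist J T) z = trace₁₂ T z := by
  have hJJ : J * Jᵀ = 1 := by rw [hJt, mul_neg, hJ, neg_neg]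
  have hs : ∀ i, J *ᵥ (Pi.single i 1) = ∑ k, J k i • (Pi.single k 1 : Comp) := by
    intro i
    ext k
    simp [Finset.sum_apply, Pi.single_apply]
  have hB : ∀ i, twist J T (Pi.single i 1) (Pi.single i 1) z =
      ∑ k, ∑ l, J k i * J l i * T (Pi.single k 1) (Pi.single l 1) z := by
    intro i
    simp only [twist_apply, hs, map_sum, map_smul, LinearMap.sum_apply, LinearMap.smul_apply,
      smul_eq_mul, Finset.mul_sum]
    rw [Finset.sum_comm]
    exact Finset.sum_congr rfl fun k _ => Finset.sum_congr rfl fun l _ => by ring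
  rw [trace₁₂_apply, trace₁₂_apply, Finset.sum_congr rfl fun i _ => hB i, Finset.sum_comm]
  refine Finset.sum_congr rfl fun k _ => ?_
  rw [Finset.sum_comm]
  have h1 : ∀ l, ∑ i, J k i * J l i * T (Pi.single k 1) (Pi.single l 1) z =
      (1 : Matrix (Fin 6) (Fin 6) ℝ) k l * T (Pi.single k 1) (Pi.single l 1) z := by
    intro l
    rw [← hJJ, Matrix.mul_apply, Finset.sum_mul]
    rfl
  simp [h1, Matrix.one_apply]

theorem trace₁₂_of_isAnti (hJ : J * J = -1) (hJt : Jᵀ = -J) (hA : IsAnti J T) (z : Comp) :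
    trace₁₂ T z = 0 := by
  have h1 := trace₁₂_twist (T := T) hJ hJt z
  have h2 : trace₁₂ (twist J T) z = -trace₁₂ T z := by
    simp only [trace₁₂_apply, twist_apply, hA _ _ _, Finset.sum_neg_distrib]
  linarith

/-- The tensor in `𝒲₄` determined by a 1-form. -/
def pureTrace (J : Matrix (Fin 6) (Fin 6) ℝ) (θ : Comp →ₗ[ℝ] ℝ) (x y z : Comp) : ℝ :=
  (x ⬝ᵥ y) * θ z - (x ⬝ᵥ z) * θ y
        - (x ⬝ᵥ (J *ᵥ y)) * θ (J *ᵥ z) + (x ⬝ᵥ (J *ᵥ z)) * θ (J *ᵥ y)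

/-- The four terms contribute `6θ`, `-θ`, `0` and `-θ`; the third vanishes because a skew matrix has
zero diagonal. Hence the factor `1 / 4` in `mem_W₃_sup_W₄`. -/
theorem sum_pureTrace (hJ : J * J = -1) (hJt : Jᵀ = -J) (θ : Comp →ₗ[ℝ] ℝ) (z : Comp) :
    ∑ i, pureTrace J θ (Pi.single i 1) (Pi.single i 1) z = 4 * θ z := by
  have hθ : ∀ w : Comp, ∑ i, w i * θ (Pi.single i 1) = θ w := fun w => by
    conv_rhs => rw [← Finset.univ_sum_single w]
    rw [map_sum]
    refine Finset.sum_congr rfl fun i _ => ?_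
    rw [← smul_eq_mul, ← map_smul, ← Pi.single_smul, smul_eq_mul, mul_one]
  have hd : ∀ i, J i i = 0 := fun i => by
    have := congrFun (congrFun hJt i) i
    rw [transpose_apply, neg_apply] at this
    linarith
  have h3 : ∑ i, (J *ᵥ z) i * θ (J *ᵥ Pi.single i 1) = - θ z := by
    rw [← map_neg, ← mulVec_mulVec_of_sq hJ]
    conv_rhs => rw [← Finset.univ_sum_single (J *ᵥ z)]
    rw [mulVec_sum, map_sum]
    refine Finset.sum_congr rfl fun i _ => ?_
    rw [← smul_eq_mul, ← map_smul, ← mulVec_smul, ← Pi.single_smul, smul_eq_mul, mul_one]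
  simp only [pureTrace, Finset.sum_add_distrib, Finset.sum_sub_distrib, single_dotProduct, one_mul,
    hθ, h3]
  simp [hd]
  ring

/-- `pureTrace` as a tensor. -/
def pureTraceTensor (J : Matrix (Fin 6) (Fin 6) ℝ) (θ : Comp →ₗ[ℝ] ℝ) : Tensor3 :=
  ∑ i, (LinearMap.proj i : Comp →ₗ[ℝ] ℝ).smulRight
    ((LinearMap.proj i : Comp →ₗ[ℝ] ℝ).smulRight θ
      + (-1 : ℝ) • θ.smulRight (LinearMap.proj i : Comp →ₗ[ℝ] ℝ)
      + (-1 : ℝ) • (LinearMap.proj i ∘ₗ J.mulVecLin).smulRight (θ ∘ₗ J.mulVecLin)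
      + (θ ∘ₗ J.mulVecLin).smulRight (LinearMap.proj i ∘ₗ J.mulVecLin))

theorem pureTraceTensor_apply (θ : Comp →ₗ[ℝ] ℝ) (x y z : Comp) :
    pureTraceTensor J θ x y z = pureTrace J θ x y z := by
  have h : pureTraceTensor J θ x y z = ∑ i, x i * (y i * θ z + (-1) * (θ y * z i)
      + (-1) * ((J *ᵥ y) i * θ (J *ᵥ z)) + θ (J *ᵥ y) * (J *ᵥ z) i) := by
    rw [pureTraceTensor, LinearMap.sum_apply, LinearMap.sum_apply, LinearMap.sum_apply]
    rfl
  rw [h, pureTrace, dotProduct, dotProduct, dotProduct, dotProduct, Finset.sum_mul, Finset.sum_mul,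
    Finset.sum_mul, Finset.sum_mul, ← Finset.sum_sub_distrib, ← Finset.sum_sub_distrib,
    ← Finset.sum_add_distrib]
  exact Finset.sum_congr rfl fun i _ => by ring

theorem pureTraceTensor_mem (hJ : J * J = -1) (θ : Comp →ₗ[ℝ] ℝ) : pureTraceTensor J θ ∈ W₄ J := by
  refine ⟨⟨fun x y z => ?_, fun x y z => ?_⟩, θ, fun x y z => ?_⟩
  · rw [pureTraceTensor_apply, pureTraceTensor_apply, pureTrace, pureTrace]
    ring
  · rw [pureTraceTensor_apply, pureTraceTensor_apply, pureTrace, pureTrace]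
    simp only [mulVec_mulVec_of_sq hJ, dotProduct_neg, map_neg]
    ring
  · rw [pureTraceTensor_apply, pureTrace]

theorem mem_W₃_of_isSym (hT : T ∈ W J) (hS : IsSym J T) (h : ∀ z, trace₁₂ T z = 0) : T ∈ W₃ J :=
  ⟨hT, fun x y z => (hS x y z).symm, fun z => by rw [← trace₁₂_apply, h]⟩

theorem mem_W₃_sup_W₄ (hJ : J * J = -1) (hJt : Jᵀ = -J) (hT : T ∈ W J) (hS : IsSym J T) :
    T ∈ W₃ J ⊔ W₄ J := by
  set R := pureTraceTensor J ((1 / 4 : ℝ) • trace₁₂ T) with hR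
  have hRm : R ∈ W₄ J := pureTraceTensor_mem hJ _
  have hRs := isSym_of_mem_W₄ hJ hJt hRm
  have hRt : ∀ z, trace₁₂ R z = trace₁₂ T z := fun z => by
    rw [trace₁₂_apply, hR]
    simp only [pureTraceTensor_apply, sum_pureTrace hJ hJt, LinearMap.smul_apply, smul_eq_mul]
    ring
  refine Submodule.mem_sup.2 ⟨T + (-1 : ℝ) • R, mem_W₃_of_isSym
    ((W J).add_mem hT ((W J).smul_mem _ hRm.1)) (fun x y z => ?_) (fun z => ?_), R, hRm, ?_⟩
  · simp only [LinearMap.add_apply, LinearMap.smul_apply, hS x y z, hRs x y z]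
  · rw [trace₁₂_add, trace₁₂_smul, hRt]
    ring
  · refine LinearMap.ext fun x => LinearMap.ext fun y => LinearMap.ext fun z => ?_
    simp only [LinearMap.add_apply, LinearMap.smul_apply, smul_eq_mul]
    ring

theorem mem_W₂₃₄_iff (hJ : J * J = -1) (hJt : Jᵀ = -J) (hT : T ∈ W J) :
    T ∈ W₂ J ⊔ W₃ J ⊔ W₄ J ↔ ∀ x y z, antiPart J T x y z + antiPart J T y z x
      + antiPart J T z x y = 0 := by
  constructor
  · intro h
    rw [sup_assoc] at h
    obtain ⟨S, hS, R, hR, rfl⟩ := Submodule.mem_sup.1 h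
    have hSa := isAnti_of_mem_W₂ hJ hS
    have hRs := isSym_of_mem_W₃_sup_W₄ hJ hJt hR
    have : ∀ x y z, antiPart J (S + R) x y z = S x y z := fun x y z => by
      rw [antiPart_apply]
      simp only [LinearMap.add_apply, hSa x y z, hRs x y z]
      ring
    intro x y z
    rw [this, this, this, hS.2]
  · intro h
    rw [sup_assoc, ← antiPart_add_symPart (J := J) (T := T)]
    exact Submodule.add_mem_sup ⟨antiPart_mem_W hJ hT, h⟩
      (mem_W₃_sup_W₄ hJ hJt (symPart_mem_W hJ hT) (isSym_symPart hJ))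

theorem mem_W₁₃₄_iff (hJ : J * J = -1) (hJt : Jᵀ = -J) (hT : T ∈ W J) :
    T ∈ W₁ J ⊔ W₃ J ⊔ W₄ J ↔ ∀ x z, antiPart J T x x z = 0 := by
  constructor
  · intro h
    rw [sup_assoc] at h
    obtain ⟨S, hS, R, hR, rfl⟩ := Submodule.mem_sup.1 h
    have hSa := isAnti_of_mem_W₁ hS
    have hRs := isSym_of_mem_W₃_sup_W₄ hJ hJt hR
    intro x z
    rw [antiPart_apply]
    simp only [LinearMap.add_apply, hSa x x z, hRs x x z, hS.2 x z]
    ring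
  · intro h
    rw [sup_assoc, ← antiPart_add_symPart (J := J) (T := T)]
    exact Submodule.add_mem_sup ⟨antiPart_mem_W hJ hT, h⟩
      (mem_W₃_sup_W₄ hJ hJt (symPart_mem_W hJ hT) (isSym_symPart hJ))

theorem mem_W₁₂₃_iff (hJ : J * J = -1) (hJt : Jᵀ = -J) (hT : T ∈ W J) :
    T ∈ W₁ J ⊔ W₂ J ⊔ W₃ J ↔ ∀ z, trace₁₂ T z = 0 := by
  constructor
  · intro h
    obtain ⟨S, hS, R, hR, rfl⟩ := Submodule.mem_sup.1 h
    intro z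
    rw [trace₁₂_add, trace₁₂_of_isAnti hJ hJt (isAnti_of_mem_W₁_sup_W₂ hJ hS), trace₁₂_apply,
      hR.2.2 z, add_zero]
  · intro h
    rw [← antiPart_add_symPart (J := J) (T := T)]
    refine Submodule.add_mem_sup (mem_W₁_sup_W₂ hJ (antiPart_mem_W hJ hT) (isAnti_antiPart hJ))
      (mem_W₃_of_isSym (symPart_mem_W hJ hT) (isSym_symPart hJ) fun z => ?_)
    rw [symPart, trace₁₂_smul, trace₁₂_add, trace₁₂_twist hJ hJt, h]
    ring

/-- Only this necessary condition is needed for `𝒵₁₂₄`; the structures found there are checked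
directly to lie in `𝒲₂` or in `𝒲₁ ⊕ 𝒲₂`. -/
theorem exists_symPart_eq_pureTrace (hJ : J * J = -1) (hJt : Jᵀ = -J)
    (hT : T ∈ W₁ J ⊔ W₂ J ⊔ W₄ J) : ∃ θ, ∀ x y z, symPart J T x y z = pureTrace J θ x y z := by
  obtain ⟨S, hS, R, hR, rfl⟩ := Submodule.mem_sup.1 hT
  have hSa := isAnti_of_mem_W₁_sup_W₂ hJ hS
  have hRs := isSym_of_mem_W₄ hJ hJt hR
  obtain ⟨θ, hθ⟩ := hR.2
  refine ⟨θ, fun x y z => ?_⟩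
  rw [symPart_apply]
  simp only [LinearMap.add_apply, hSa x y z, hRs x y z]
  rw [hθ, pureTrace]
  ring

end GrayHervella

/-! ### The Klein correspondence: from `u` to an almost complex structure -/

theorem form_eq_transpose (J : Matrix (Fin 6) (Fin 6) ℝ) : form J = Jᵀ := by
  ext i j
  simp [form]

/-- The skew matrix with given entries above the diagonal. -/
def skewMatrix (a₁ a₂ a₃ a₄ a₅ b₂ b₃ b₄ b₅ c₃ c₄ c₅ d₄ d₅ f : ℝ) : Matrix (Fin 6) (Fin 6) ℝ :=
  !![0, a₁, a₂, a₃, a₄, a₅;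
    -a₁, 0, b₂, b₃, b₄, b₅;
    -a₂, -b₂, 0, c₃, c₄, c₅;
    -a₃, -b₃, -c₃, 0, d₄, d₅;
    -a₄, -b₄, -c₄, -d₄, 0, f;
    -a₅, -b₅, -c₅, -d₅, -f, 0]

theorem eq_skewMatrix {J : Matrix (Fin 6) (Fin 6) ℝ} (hJ : Jᵀ = -J) :
    J = skewMatrix (J 0 1) (J 0 2) (J 0 3) (J 0 4) (J 0 5) (J 1 2) (J 1 3) (J 1 4) (J 1 5)
      (J 2 3) (J 2 4) (J 2 5) (J 3 4) (J 3 5) (J 4 5) := by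
  have h : ∀ i j, J j i = -J i j := fun i j => congrFun (congrFun hJ i) j
  have hd : ∀ i, J i i = 0 := fun i => by linarith [h i i]
  ext i j
  fin_cases i <;> fin_cases j <;> simp [skewMatrix, hd] <;> exact h _ _

theorem smul_skewMatrix (c a₁ a₂ a₃ a₄ a₅ b₂ b₃ b₄ b₅ c₃ c₄ c₅ d₄ d₅ f : ℝ) :
    c • skewMatrix a₁ a₂ a₃ a₄ a₅ b₂ b₃ b₄ b₅ c₃ c₄ c₅ d₄ d₅ f =
      skewMatrix (c * a₁) (c * a₂) (c * a₃) (c * a₄) (c * a₅) (c * b₂) (c * b₃) (c * b₄) (c * b₅)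
        (c * c₃) (c * c₄) (c * c₅) (c * d₄) (c * d₅) (c * f) := by
  ext i j
  fin_cases i <;> fin_cases j <;> simp [skewMatrix]

/-- The squared norm of a vector in `ℂ⁴`. -/
def spinorNormSq (u : Fin 4 → ℂ) : ℝ := ∑ i, ((u i).re * (u i).re + (u i).im * (u i).im)

theorem spinorNormSq_pos {u : Fin 4 → ℂ} (hu : u ≠ 0) : 0 < spinorNormSq u := by
  have h0 : ∀ i, 0 ≤ (u i).re * (u i).re + (u i).im * (u i).im := fun i =>
    add_nonneg (mul_self_nonneg _) (mul_self_nonneg _)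
  refine lt_of_le_of_ne (Finset.sum_nonneg fun i _ => h0 i) fun h => hu ?_
  have := (Finset.sum_eq_zero_iff_of_nonneg fun i _ => h0 i).1 h.symm
  ext1 i
  have hi := this i (Finset.mem_univ i)
  apply Complex.ext <;> simp <;> nlinarith [mul_self_nonneg (u i).re, mul_self_nonneg (u i).im]

/-- The real part of `u_i ū_j`. -/
def hermRe (u : Fin 4 → ℂ) (i j : Fin 4) : ℝ := (u i).re * (u j).re + (u i).im * (u j).im

/-- The imaginary part of `u_i ū_j`. -/
def hermIm (u : Fin 4 → ℂ) (i j : Fin 4) : ℝ := (u i).im * (u j).re - (u i).re * (u j).im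

/-- The structure determined by `u`, multiplied by the squared norm of `u`. -/
def kleinMatrix (u : Fin 4 → ℂ) : Matrix (Fin 6) (Fin 6) ℝ :=
  let r := hermRe u
  let s := hermIm u
  skewMatrix (-r 0 0 - r 1 1 + r 2 2 + r 3 3)
    (2 * s 0 3 + 2 * s 1 2) (2 * r 0 3 - 2 * r 1 2) (-2 * s 0 2 + 2 * s 1 3)
    (-2 * r 0 2 - 2 * r 1 3)
    (2 * r 0 3 + 2 * r 1 2) (-2 * s 0 3 + 2 * s 1 2) (-2 * r 0 2 + 2 * r 1 3)
    (2 * s 0 2 + 2 * s 1 3)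
    (-r 0 0 - r 2 2 + r 1 1 + r 3 3) (2 * s 0 1 + 2 * s 2 3) (2 * r 0 1 - 2 * r 2 3)
    (2 * r 0 1 + 2 * r 2 3) (-2 * s 0 1 + 2 * s 2 3)
    (-r 0 0 - r 3 3 + r 1 1 + r 2 2)

theorem kleinMatrix_transpose (u : Fin 4 → ℂ) : (kleinMatrix u)ᵀ = -kleinMatrix u := by
  ext i j
  fin_cases i <;> fin_cases j <;> simp [kleinMatrix, skewMatrix] <;> ring

set_option maxHeartbeats 2000000 in
theorem kleinMatrix_mul_self (u : Fin 4 → ℂ) :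
    kleinMatrix u * kleinMatrix u = -(spinorNormSq u ^ 2) • (1 : Matrix (Fin 6) (Fin 6) ℝ) := by
  have hs : ∀ i j, (kleinMatrix u * kleinMatrix u) i j = (kleinMatrix u * kleinMatrix u) j i := by
    intro i j
    rw [← transpose_apply (kleinMatrix u * kleinMatrix u) i j, transpose_mul, kleinMatrix_transpose,
      neg_mul_neg]
  have h : ∀ i j, i ≤ j → (kleinMatrix u * kleinMatrix u) i j =
      (-(spinorNormSq u ^ 2) • (1 : Matrix (Fin 6) (Fin 6) ℝ)) i j := by
    intro i j hij
    rw [Matrix.mul_apply, Fin.sum_univ_six]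
    fin_cases i <;> fin_cases j <;> first
      | exact absurd hij (by decide)
      | (simp [kleinMatrix, skewMatrix, hermRe, hermIm, spinorNormSq, Fin.sum_univ_four]; ring)
  ext i j
  rcases le_total i j with hij | hij
  · exact h i j hij
  · rw [hs, h j i hij]
    simp [Matrix.one_apply, eq_comm]

set_option maxHeartbeats 2000000 in
theorem pfaffian_kleinMatrix (u : Fin 4 → ℂ) :
    pfaffian (kleinMatrix u)ᵀ = spinorNormSq u ^ 3 := by
  simp [pfaffian, kleinMatrix, skewMatrix, hermRe, hermIm, spinorNormSq, Fin.sum_univ_four]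
  ring

set_option maxHeartbeats 2000000 in
theorem kleinWedge_vecMul_kleinMatrix (u v : Fin 4 → ℂ) :
    kleinWedge u v ᵥ* (kleinMatrix u).map Complex.ofReal =
      (Complex.I * spinorNormSq u) • kleinWedge u v := by
  ext i
  fin_cases i <;> apply Complex.ext <;>
    simp [kleinWedge, kleinMatrix, skewMatrix, hermRe, hermIm, spinorNormSq, Fin.sum_univ_four,
      vecMul, dotProduct, Fin.sum_univ_six] <;> ring

/-- The contraction of a complex 1-form, as an element of `Λ² ℂ⁴`, with the conjugate of `u`. -/
def contract (u : Fin 4 → ℂ) (α : Fin 6 → ℂ) : Fin 4 → ℂ :=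
  let c : Fin 4 → ℂ := fun i => (starRingEnd ℂ) (u i)
  ![-c 1 * (α 0 - Complex.I * α 1) - c 2 * (α 2 - Complex.I * α 3) - c 3 * (α 4 - Complex.I * α 5),
    c 0 * (α 0 - Complex.I * α 1) - c 2 * (α 4 + Complex.I * α 5) + c 3 * (α 2 + Complex.I * α 3),
    c 0 * (α 2 - Complex.I * α 3) + c 1 * (α 4 + Complex.I * α 5) - c 3 * (α 0 + Complex.I * α 1),
    c 0 * (α 4 - Complex.I * α 5) - c 1 * (α 2 + Complex.I * α 3) + c 2 * (α 0 + Complex.I * α 1)]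

-- Wedging with `u` after contracting with `ū` is, up to scale, the projection onto `V_u`; the
-- right-hand side is, up to scale, the projection onto the `i`-eigenspace. This shows that the
-- eigenspace is no larger than `V_u`.
set_option maxHeartbeats 2000000 in
theorem kleinWedge_contract (u : Fin 4 → ℂ) (α : Fin 6 → ℂ) :
    (2 : ℂ) • kleinWedge u (contract u α) =
      (spinorNormSq u : ℂ) • α - Complex.I • (α ᵥ* (kleinMatrix u).map Complex.ofReal) := by
  ext i
  fin_cases i <;> apply Complex.ext <;>
    simp [kleinWedge, contract, kleinMatrix, skewMatrix, hermRe, hermIm, spinorNormSq,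
      Fin.sum_univ_four, vecMul, dotProduct, Fin.sum_univ_six] <;> ring

theorem pfaffian_smul (c : ℝ) (w : Matrix (Fin 6) (Fin 6) ℝ) :
    pfaffian (c • w) = c ^ 3 * pfaffian w := by
  simp only [pfaffian, Matrix.smul_apply, smul_eq_mul]
  ring

theorem transpose_of_mem_acs {J : Matrix (Fin 6) (Fin 6) ℝ} (hJ : J ∈ acs) : Jᵀ = -J := by
  have h : Jᵀ * (J * J) = J := by rw [← mul_assoc, hJ.2.1, one_mul]
  rw [hJ.1, mul_neg, mul_one] at h
  exact neg_eq_iff_eq_neg.1 h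

/-- The almost complex structure for which the `i`-eigenspace on complex 1-forms is
`{u ∧ v : v ∈ ℂ⁴}`. -/
def structureOf (u : Fin 4 → ℂ) : Matrix (Fin 6) (Fin 6) ℝ := (spinorNormSq u)⁻¹ • kleinMatrix u

theorem structureOf_mem_acs {u : Fin 4 → ℂ} (hu : u ≠ 0) : structureOf u ∈ acs := by
  have hn := spinorNormSq_pos hu
  have h1 : structureOf u * structureOf u = -1 := by
    rw [structureOf, smul_mul_smul_comm, kleinMatrix_mul_self, smul_smul]
    have : (spinorNormSq u)⁻¹ * (spinorNormSq u)⁻¹ * -spinorNormSq u ^ 2 = -1 := by field_simp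
    rw [this, neg_smul, one_smul]
  have h2 : (structureOf u)ᵀ = -structureOf u := by
    rw [structureOf, transpose_smul, kleinMatrix_transpose, smul_neg]
  refine ⟨h1, by rw [h2, neg_mul, h1, neg_neg], ?_⟩
  rw [form_eq_transpose, structureOf, transpose_smul, pfaffian_smul, pfaffian_kleinMatrix]
  positivity

theorem vecMul_structureOf (u : Fin 4 → ℂ) (α : Fin 6 → ℂ) :
    α ᵥ* (structureOf u).map Complex.ofReal =
      (spinorNormSq u : ℂ)⁻¹ • (α ᵥ* (kleinMatrix u).map Complex.ofReal) := by
  have : (structureOf u).map Complex.ofReal =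
      (spinorNormSq u : ℂ)⁻¹ • (kleinMatrix u).map Complex.ofReal := by
    ext i j
    simp [structureOf]
  rw [this, vecMul_smul]

theorem iEigenspace_structureOf {u : Fin 4 → ℂ} (hu : u ≠ 0) :
    iEigenspace (structureOf u) = isotropicSpace u := by
  have hn : (spinorNormSq u : ℂ) ≠ 0 := Complex.ofReal_ne_zero.2 (spinorNormSq_pos hu).ne'
  ext α
  constructor
  · intro h
    have h' : α ᵥ* (kleinMatrix u).map Complex.ofReal = (spinorNormSq u * Complex.I : ℂ) • α := by
      rw [mul_smul, ← (h : _ = Complex.I • α), vecMul_structureOf, smul_smul, mul_inv_cancel₀ hn,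
        one_smul]
    refine ⟨(spinorNormSq u : ℂ)⁻¹ • contract u α, ?_⟩
    have hk := kleinWedge_contract u α
    rw [h', smul_smul] at hk
    have hl : kleinWedge u ((spinorNormSq u : ℂ)⁻¹ • contract u α) =
        (spinorNormSq u : ℂ)⁻¹ • kleinWedge u (contract u α) := by
      ext i
      fin_cases i <;> simp [kleinWedge] <;> ring
    rw [hl]
    ext i
    have hi := congrFun hk i
    simp only [Pi.smul_apply, Pi.sub_apply, smul_eq_mul] at hi ⊢
    rw [inv_mul_eq_iff_eq_mul₀ hn]
    linear_combination hi / 2 - spinorNormSq u * α i / 2 * Complex.I_mul_I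
  · rintro ⟨v, rfl⟩
    change _ = _
    rw [vecMul_structureOf, kleinWedge_vecMul_kleinMatrix, smul_smul, mul_comm Complex.I,
      inv_mul_cancel_left₀ hn]

/-- For real `x`, the form `x - i xJ` lies in the `i`-eigenspace of `J`. If it is also an
eigenvector of `K`, the real part of the eigenvalue equation reads `xK = xJ`. -/
theorem eq_of_iEigenspace_subset {J K : Matrix (Fin 6) (Fin 6) ℝ} (hJ : J * J = -1)
    (h : iEigenspace J ⊆ iEigenspace K) : J = K := by
  have key : ∀ x : Comp, x ᵥ* J = x ᵥ* K := by
    intro x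
    have hc : ∀ (y : Comp) (L : Matrix (Fin 6) (Fin 6) ℝ) (j : Fin 6),
        ((fun i => (y i : ℂ)) ᵥ* L.map Complex.ofReal) j = ((y ᵥ* L) j : ℂ) := by
      intro y L j
      simp [vecMul, dotProduct]
    have hα : (fun i => (x i : ℂ)) - Complex.I • (fun i => ((x ᵥ* J) i : ℂ)) ∈ iEigenspace J := by
      change _ ᵥ* _ = _
      ext j
      rw [sub_vecMul, smul_vecMul, Pi.sub_apply, Pi.smul_apply, hc, hc, vecMul_vecMul, hJ]
      simp [mul_sub, ← mul_assoc, vecMul_neg]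
      ring
    have hK := h hα
    ext j
    have hj := congrFun (hK : _ ᵥ* _ = _) j
    rw [sub_vecMul, smul_vecMul, Pi.sub_apply, Pi.smul_apply, hc, hc] at hj
    have := congrArg Complex.re hj
    simp at this
    exact this.symm
  ext i j
  have := congrFun (key (Pi.single i 1)) j
  simpa using this

theorem eq_structureOf {J : Matrix (Fin 6) (Fin 6) ℝ} (hJ : J ∈ acs) {u : Fin 4 → ℂ} (hu : u ≠ 0)
    (h : iEigenspace J = isotropicSpace u) : J = structureOf u :=
  eq_of_iEigenspace_subset hJ.1 (by rw [h, iEigenspace_structureOf hu])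

theorem spinorNormSq_smul (c : ℂ) (u : Fin 4 → ℂ) :
    spinorNormSq (c • u) = Complex.normSq c * spinorNormSq u := by
  simp [spinorNormSq, Fin.sum_univ_four, Complex.normSq_apply]
  ring

theorem kleinMatrix_smul (c : ℂ) (u : Fin 4 → ℂ) :
    kleinMatrix (c • u) = Complex.normSq c • kleinMatrix u := by
  have hr : ∀ i j, hermRe (c • u) i j = Complex.normSq c * hermRe u i j := fun i j => by
    simp [hermRe, Complex.normSq_apply]
    ring
  have hs : ∀ i j, hermIm (c • u) i j = Complex.normSq c * hermIm u i j := fun i j => by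
    simp [hermIm, Complex.normSq_apply]
    ring
  ext i j
  fin_cases i <;> fin_cases j <;> simp [kleinMatrix, skewMatrix, hr, hs] <;> ring

theorem structureOf_smul {c : ℂ} (hc : c ≠ 0) (u : Fin 4 → ℂ) :
    structureOf (c • u) = structureOf u := by
  have : Complex.normSq c ≠ 0 := by simpa using hc
  rw [structureOf, structureOf, kleinMatrix_smul, spinorNormSq_smul, smul_smul, mul_inv,
    mul_right_comm, inv_mul_cancel₀ this, one_mul]

/-! ### Injectivity of the correspondence -/

theorem spinorNormSq_eq (u : Fin 4 → ℂ) :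
    spinorNormSq u = hermRe u 0 0 + hermRe u 1 1 + hermRe u 2 2 + hermRe u 3 3 := by
  rw [spinorNormSq, Fin.sum_univ_four]
  rfl

/-- The 15 entries above the diagonal and `|u|²` are 16 independent real-linear functions of the 16
real parameters of `(u_i ū_j)`, so they can be inverted linearly. -/
theorem herm_of_structureOf_eq {u w : Fin 4 → ℂ} (hu : u ≠ 0) (hw : w ≠ 0)
    (h : structureOf u = structureOf w) (i j : Fin 4) :
    spinorNormSq w * hermRe u i j = spinorNormSq u * hermRe w i j ∧
      spinorNormSq w * hermIm u i j = spinorNormSq u * hermIm w i j := by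
  have hK : ∀ k l, spinorNormSq w * kleinMatrix u k l = spinorNormSq u * kleinMatrix w k l := by
    intro k l
    have hkl := congrFun (congrFun h k) l
    have h1 := (spinorNormSq_pos hu).ne'
    have h2 := (spinorNormSq_pos hw).ne'
    simp only [structureOf, Matrix.smul_apply, smul_eq_mul] at hkl
    field_simp at hkl
    linarith
  have hn : spinorNormSq w * (hermRe u 0 0 + hermRe u 1 1 + hermRe u 2 2 + hermRe u 3 3) =
      spinorNormSq u * (hermRe w 0 0 + hermRe w 1 1 + hermRe w 2 2 + hermRe w 3 3) := by
    rw [← spinorNormSq_eq, ← spinorNormSq_eq, mul_comm]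
  have rc : ∀ v k l, hermRe v k l = hermRe v l k := fun v k l => by simp only [hermRe]; ring
  have sc : ∀ v k l, hermIm v k l = -hermIm v l k := fun v k l => by simp only [hermIm]; ring
  have sd : ∀ v k, hermIm v k k = 0 := fun v k => by simp only [hermIm]; ring
  have a1 := hK 0 1
  have a2 := hK 0 2
  have a3 := hK 0 3
  have a4 := hK 0 4
  have a5 := hK 0 5
  have b2 := hK 1 2
  have b3 := hK 1 3
  have b4 := hK 1 4
  have b5 := hK 1 5
  have c3 := hK 2 3
  have c4 := hK 2 4
  have c5 := hK 2 5
  have d4 := hK 3 4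
  have d5 := hK 3 5
  have f := hK 4 5
  clear hK
  simp [kleinMatrix, skewMatrix] at a1 a2 a3 a4 a5 b2 b3 b4 b5 c3 c4 c5 d4 d5 f
  have key : ∀ k l, k ≤ l → spinorNormSq w * hermRe u k l = spinorNormSq u * hermRe w k l ∧
      spinorNormSq w * hermIm u k l = spinorNormSq u * hermIm w k l := by
    intro k l hkl
    fin_cases k <;> fin_cases l <;> first
      | exact absurd hkl (by decide)
      | (simp [sd]; first | linarith only [a1, c3, f, hn] | constructor <;> first
          | linarith only [a2, a3, b2, b3] | linarith only [a4, a5, b4, b5]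
          | linarith only [c4, c5, d4, d5])
  rcases le_total i j with hij | hij
  · exact key i j hij
  · rw [rc u, rc w, sc u, sc w, mul_neg, mul_neg, (key j i hij).1, (key j i hij).2]
    exact ⟨rfl, rfl⟩

theorem mk_eq_of_structureOf_eq {u w : Fin 4 → ℂ} (hu : u ≠ 0) (hw : w ≠ 0)
    (h : structureOf u = structureOf w) :
    Projectivization.mk ℂ u hu = Projectivization.mk ℂ w hw := by
  obtain ⟨j, hj⟩ : ∃ j, w j ≠ 0 := by
    by_contra! hc
    exact hw (funext hc)
  have hnu : (spinorNormSq u : ℂ) ≠ 0 := Complex.ofReal_ne_zero.2 (spinorNormSq_pos hu).ne'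
  have hnw : (spinorNormSq w : ℂ) ≠ 0 := Complex.ofReal_ne_zero.2 (spinorNormSq_pos hw).ne'
  have key : ∀ i, (spinorNormSq w : ℂ) * (u i * (starRingEnd ℂ) (u j)) =
      spinorNormSq u * (w i * (starRingEnd ℂ) (w j)) := by
    intro i
    obtain ⟨h1, h2⟩ := herm_of_structureOf_eq hu hw h i j
    simp only [hermRe, hermIm] at h1 h2
    apply Complex.ext
    · simp
      linarith
    · simp
      linarith
  have hcu : (starRingEnd ℂ) (u j) ≠ 0 := by
    intro h0
    have := key j
    rw [h0, mul_zero, mul_zero] at this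
    exact mul_ne_zero hnu (mul_ne_zero hj ((map_ne_zero _).2 hj)) this.symm
  rw [Projectivization.mk_eq_mk_iff']
  -- The ratio `u_i / w_i`, read off from the proportionality of `u_i ū_j` and `w_i w̄_j` for the
  -- fixed index `j` with `w_j ≠ 0`.
  refine ⟨spinorNormSq u * (starRingEnd ℂ) (w j) / (spinorNormSq w * (starRingEnd ℂ) (u j)), ?_⟩
  ext i
  rw [Pi.smul_apply, smul_eq_mul, div_mul_eq_mul_div, div_eq_iff (mul_ne_zero hnw hcu)]
  linear_combination -(key i)

/-! ### Surjectivity of the correspondence, through Pfaffians -/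

/-- The `4 × 4` Pfaffians of a skew matrix, each placed at the complementary position. -/
def pfaffianAdjugate (w : Matrix (Fin 6) (Fin 6) ℝ) : Matrix (Fin 6) (Fin 6) ℝ :=
  let q : Fin 6 → Fin 6 → Fin 6 → Fin 6 → ℝ :=
    fun a b c d => w a b * w c d - w a c * w b d + w a d * w b c
  skewMatrix (q 2 3 4 5) (-q 1 3 4 5) (q 1 2 4 5) (-q 1 2 3 5) (q 1 2 3 4)
    (q 0 3 4 5) (-q 0 2 4 5) (q 0 2 3 5) (-q 0 2 3 4)
    (q 0 1 4 5) (-q 0 1 3 5) (q 0 1 3 4)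
    (q 0 1 2 5) (-q 0 1 2 4)
    (q 0 1 2 3)

theorem pfaffianAdjugate_skewMatrix (a₁ a₂ a₃ a₄ a₅ b₂ b₃ b₄ b₅ c₃ c₄ c₅ d₄ d₅ f : ℝ) :
    pfaffianAdjugate (skewMatrix a₁ a₂ a₃ a₄ a₅ b₂ b₃ b₄ b₅ c₃ c₄ c₅ d₄ d₅ f) = skewMatrix
      (c₃ * f - c₄ * d₅ + c₅ * d₄) (-(b₃ * f - b₄ * d₅ + b₅ * d₄)) (b₂ * f - b₄ * c₅ + b₅ * c₄)
      (-(b₂ * d₅ - b₃ * c₅ + b₅ * c₃)) (b₂ * d₄ - b₃ * c₄ + b₄ * c₃)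
      (a₃ * f - a₄ * d₅ + a₅ * d₄) (-(a₂ * f - a₄ * c₅ + a₅ * c₄)) (a₂ * d₅ - a₃ * c₅ + a₅ * c₃)
      (-(a₂ * d₄ - a₃ * c₄ + a₄ * c₃))
      (a₁ * f - a₄ * b₅ + a₅ * b₄) (-(a₁ * d₅ - a₃ * b₅ + a₅ * b₃)) (a₁ * d₄ - a₃ * b₄ + a₄ * b₃)
      (a₁ * c₅ - a₂ * b₅ + a₅ * b₂) (-(a₁ * c₄ - a₂ * b₄ + a₄ * b₂))
      (a₁ * c₃ - a₂ * b₃ + a₃ * b₂) := rfl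

theorem pfaffian_skewMatrix (a₁ a₂ a₃ a₄ a₅ b₂ b₃ b₄ b₅ c₃ c₄ c₅ d₄ d₅ f : ℝ) :
    pfaffian (skewMatrix a₁ a₂ a₃ a₄ a₅ b₂ b₃ b₄ b₅ c₃ c₄ c₅ d₄ d₅ f) =
      a₁ * (c₃ * f - c₄ * d₅ + c₅ * d₄) - a₂ * (b₃ * f - b₄ * d₅ + b₅ * d₄)
        + a₃ * (b₂ * f - b₄ * c₅ + b₅ * c₄) - a₄ * (b₂ * d₅ - b₃ * c₅ + b₅ * c₃)
        + a₅ * (b₂ * d₄ - b₃ * c₄ + b₄ * c₃) := rfl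

theorem mul_pfaffianAdjugate (a₁ a₂ a₃ a₄ a₅ b₂ b₃ b₄ b₅ c₃ c₄ c₅ d₄ d₅ f : ℝ) :
    let w := skewMatrix a₁ a₂ a₃ a₄ a₅ b₂ b₃ b₄ b₅ c₃ c₄ c₅ d₄ d₅ f
    w * pfaffianAdjugate w = -pfaffian w • (1 : Matrix (Fin 6) (Fin 6) ℝ) := by
  intro w
  rw [pfaffianAdjugate_skewMatrix, pfaffian_skewMatrix]
  ext i j
  rw [Matrix.mul_apply, Fin.sum_univ_six]
  fin_cases i <;> fin_cases j <;> simp [w, skewMatrix] <;> ring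

theorem pfaffianAdjugate_smul (c : ℝ) (w : Matrix (Fin 6) (Fin 6) ℝ) :
    pfaffianAdjugate (c • w) = c ^ 2 • pfaffianAdjugate w := by
  ext i j
  fin_cases i <;> fin_cases j <;> simp [skewMatrix, pfaffianAdjugate] <;> ring

theorem pfaffianAdjugate_pfaffianAdjugate
    (a₁ a₂ a₃ a₄ a₅ b₂ b₃ b₄ b₅ c₃ c₄ c₅ d₄ d₅ f : ℝ) :
    let w := skewMatrix a₁ a₂ a₃ a₄ a₅ b₂ b₃ b₄ b₅ c₃ c₄ c₅ d₄ d₅ f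
    pfaffianAdjugate (pfaffianAdjugate w) = pfaffian w • w := by
  intro w
  rw [pfaffianAdjugate_skewMatrix, pfaffianAdjugate_skewMatrix, pfaffian_skewMatrix]
  rw [smul_skewMatrix]
  congr 1 <;> ring

/-- Multiplying `J * pfaffianAdjugate J = -Pf(J)` by `J` gives `pfaffianAdjugate J = Pf(J) J`.
Taking the Pfaffian adjugate again yields `Pf(J)³ = Pf(J)`, and the orientation selects `Pf(J) =
-1`, negative because `form J = -J`. These quadratic relations are how the orientation enters the
surjectivity proof. -/
theorem pfaffianAdjugate_of_mem_acs {J : Matrix (Fin 6) (Fin 6) ℝ} (hJ : J ∈ acs) :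
    pfaffianAdjugate J = -J := by
  have hJt := transpose_of_mem_acs hJ
  have hpf : pfaffian J < 0 := by
    have h := hJ.2.2
    rw [form_eq_transpose, hJt, ← neg_one_smul ℝ J, pfaffian_smul] at h
    linarith
  have h1 : J * pfaffianAdjugate J = -pfaffian J • (1 : Matrix (Fin 6) (Fin 6) ℝ) := by
    rw [eq_skewMatrix hJt]
    apply mul_pfaffianAdjugate
  have h2 : pfaffianAdjugate (pfaffianAdjugate J) = pfaffian J • J := by
    rw [eq_skewMatrix hJt]
    apply pfaffianAdjugate_pfaffianAdjugate
  have h3 : pfaffianAdjugate J = pfaffian J • J := by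
    have h := congrArg (J * ·) h1
    simp only [← mul_assoc, hJ.1, neg_mul, one_mul, neg_smul] at h
    rw [mul_neg, mul_smul_comm, mul_one] at h
    exact neg_injective h
  rw [h3, pfaffianAdjugate_smul, h3, smul_smul] at h2
  have h4 : pfaffian J ^ 2 * pfaffian J = pfaffian J := by
    have h := congrArg (· * J) h2
    simp only [smul_mul_assoc, hJ.1] at h
    have h00 := congrFun (congrFun h 0) 0
    simp only [Matrix.smul_apply, Matrix.neg_apply, one_apply_eq, smul_eq_mul] at h00
    linarith
  have h5 : pfaffian J = -1 := by
    have h6 : pfaffian J ^ 2 = 1 := mul_right_cancel₀ hpf.ne (h4.trans (one_mul _).symm)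
    nlinarith
  rw [h3, h5, neg_one_smul]

theorem structureOf_eq_of_smul {u : Fin 4 → ℂ} {J : Matrix (Fin 6) (Fin 6) ℝ} {c : ℝ} (hc : c ≠ 0)
    (hn : spinorNormSq u = c) (h : kleinMatrix u = c • J) : structureOf u = J := by
  rw [structureOf, hn, h, smul_smul, inv_mul_cancel₀ hc, one_smul]

-- If `J` comes from `u`, then `4 u_i ū_j / |u|²` is an affine function of the entries of `J`. Each
-- column of this hermitian matrix is a candidate for `u`, valid as soon as its diagonal entry is
-- nonzero. The quadratic relations on `J` make the matrix equal to its square divided by 4, so the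
-- squared norm of a column is 4 times its diagonal entry.
set_option maxHeartbeats 2000000 in
theorem exists_structureOf_eq_skewMatrix {a₁ a₂ a₃ a₄ a₅ b₂ b₃ b₄ b₅ c₃ c₄ c₅ d₄ d₅ f : ℝ}
    {J : Matrix (Fin 6) (Fin 6) ℝ}
    (hJ : J = skewMatrix a₁ a₂ a₃ a₄ a₅ b₂ b₃ b₄ b₅ c₃ c₄ c₅ d₄ d₅ f)
    (hJJ : J * J = -1) (hpf : pfaffianAdjugate J = -J) :
    ∃ u : Fin 4 → ℂ, u ≠ 0 ∧ structureOf u = J := by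
  subst hJ
  rw [pfaffianAdjugate_skewMatrix] at hpf
  have hh := fun i j => congrFun (congrFun hJJ i) j
  have hp := fun i j => congrFun (congrFun hpf i) j
  have h00 := hh 0 0
  have h01 := hh 0 1
  have h02 := hh 0 2
  have h03 := hh 0 3
  have h04 := hh 0 4
  have h05 := hh 0 5
  have h11 := hh 1 1
  have h12 := hh 1 2
  have h13 := hh 1 3
  have h14 := hh 1 4
  have h15 := hh 1 5
  have h22 := hh 2 2
  have h23 := hh 2 3
  have h24 := hh 2 4
  have h25 := hh 2 5
  have h33 := hh 3 3
  have h34 := hh 3 4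
  have h35 := hh 3 5
  have h44 := hh 4 4
  have h45 := hh 4 5
  have h55 := hh 5 5
  have p01 := hp 0 1
  have p02 := hp 0 2
  have p03 := hp 0 3
  have p04 := hp 0 4
  have p05 := hp 0 5
  have p12 := hp 1 2
  have p13 := hp 1 3
  have p14 := hp 1 4
  have p15 := hp 1 5
  have p23 := hp 2 3
  have p24 := hp 2 4
  have p25 := hp 2 5
  have p34 := hp 3 4
  have p35 := hp 3 5
  have p45 := hp 4 5
  clear hh hp hJJ hpf
  simp [skewMatrix, Matrix.mul_apply, Fin.sum_univ_six] at h00 h01 h02 h03 h04 h05 h11 h12 h13 h14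
  simp [skewMatrix, Matrix.mul_apply, Fin.sum_univ_six] at h15 h22 h23 h24 h25 h33 h34 h35 h44 h45 h55
  simp [skewMatrix] at p01 p02 p03 p04 p05 p12 p13 p14 p15 p23 p24 p25 p34 p35 p45
  have col0 : 1 - a₁ - c₃ - f ≠ 0 → ∃ u : Fin 4 → ℂ, u ≠ 0 ∧ structureOf u =
      skewMatrix a₁ a₂ a₃ a₄ a₅ b₂ b₃ b₄ b₅ c₃ c₄ c₅ d₄ d₅ f := by
    intro hne
    refine ⟨![⟨1 - a₁ - c₃ - f, 0⟩, ⟨c₅ + d₄, -(c₄ - d₅)⟩, ⟨-a₅ - b₄, -(b₅ - a₄)⟩, ⟨a₃ + b₂,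
      -(a₂ - b₃)⟩],
      fun h0 => hne (congrArg Complex.re (congrFun h0 0)),
      structureOf_eq_of_smul (mul_ne_zero four_ne_zero hne) ?_ ?_⟩
    · simp [spinorNormSq, Fin.sum_univ_four]
      linarith only [h00, h11, h22, h33, h44, h55, p01, p23, p45, h02, h13, h03, h12, p02, p13,
        p03, p12,
        h04, h15, h05, h14, p04, p15, p05, p14, h24, h35, h25, h34, p24, p35, p25, p34]
    · rw [smul_skewMatrix, kleinMatrix]
      congr 1 <;> simp [hermRe, hermIm] <;> first
        | linarith only [h00, h11, h22, h33, h44, h55, p01, p23, p45]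
        | linarith only [h02, h13, h03, h12, p02, p13, p03, p12]
        | linarith only [h04, h15, h05, h14, p04, p15, p05, p14]
        | linarith only [h24, h35, h25, h34, p24, p35, p25, p34]
  have col1 : 1 - a₁ + c₃ + f ≠ 0 → ∃ u : Fin 4 → ℂ, u ≠ 0 ∧ structureOf u =
      skewMatrix a₁ a₂ a₃ a₄ a₅ b₂ b₃ b₄ b₅ c₃ c₄ c₅ d₄ d₅ f := by
    intro hne
    refine ⟨![⟨c₅ + d₄, c₄ - d₅⟩, ⟨1 - a₁ + c₃ + f, 0⟩, ⟨b₂ - a₃, -(a₂ + b₃)⟩, ⟨b₄ - a₅,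
      -(a₄ + b₅)⟩],
      fun h0 => hne (congrArg Complex.re (congrFun h0 1)),
      structureOf_eq_of_smul (mul_ne_zero four_ne_zero hne) ?_ ?_⟩
    · simp [spinorNormSq, Fin.sum_univ_four]
      linarith only [h00, h11, h22, h33, h44, h55, p01, p23, p45, h02, h13, h03, h12, p02, p13,
        p03, p12,
        h04, h15, h05, h14, p04, p15, p05, p14, h24, h35, h25, h34, p24, p35, p25, p34]
    · rw [smul_skewMatrix, kleinMatrix]
      congr 1 <;> simp [hermRe, hermIm] <;> first
        | linarith only [h00, h11, h22, h33, h44, h55, p01, p23, p45]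
        | linarith only [h02, h13, h03, h12, p02, p13, p03, p12]
        | linarith only [h04, h15, h05, h14, p04, p15, p05, p14]
        | linarith only [h24, h35, h25, h34, p24, p35, p25, p34]
  have col2 : 1 + a₁ - c₃ + f ≠ 0 → ∃ u : Fin 4 → ℂ, u ≠ 0 ∧ structureOf u =
      skewMatrix a₁ a₂ a₃ a₄ a₅ b₂ b₃ b₄ b₅ c₃ c₄ c₅ d₄ d₅ f := by
    intro hne
    refine ⟨![⟨-a₅ - b₄, b₅ - a₄⟩, ⟨b₂ - a₃, a₂ + b₃⟩, ⟨1 + a₁ - c₃ + f, 0⟩, ⟨d₄ - c₅, -(c₄ + d₅)⟩],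
      fun h0 => hne (congrArg Complex.re (congrFun h0 2)),
      structureOf_eq_of_smul (mul_ne_zero four_ne_zero hne) ?_ ?_⟩
    · simp [spinorNormSq, Fin.sum_univ_four]
      linarith only [h00, h11, h22, h33, h44, h55, p01, p23, p45, h02, h13, h03, h12, p02, p13,
        p03, p12,
        h04, h15, h05, h14, p04, p15, p05, p14, h24, h35, h25, h34, p24, p35, p25, p34]
    · rw [smul_skewMatrix, kleinMatrix]
      congr 1 <;> simp [hermRe, hermIm] <;> first
        | linarith only [h00, h11, h22, h33, h44, h55, p01, p23, p45]
        | linarith only [h02, h13, h03, h12, p02, p13, p03, p12]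
        | linarith only [h04, h15, h05, h14, p04, p15, p05, p14]
        | linarith only [h24, h35, h25, h34, p24, p35, p25, p34]
  have col3 : 1 + a₁ + c₃ - f ≠ 0 → ∃ u : Fin 4 → ℂ, u ≠ 0 ∧ structureOf u =
      skewMatrix a₁ a₂ a₃ a₄ a₅ b₂ b₃ b₄ b₅ c₃ c₄ c₅ d₄ d₅ f := by
    intro hne
    refine ⟨![⟨a₃ + b₂, a₂ - b₃⟩, ⟨b₄ - a₅, a₄ + b₅⟩, ⟨d₄ - c₅, c₄ + d₅⟩, ⟨1 + a₁ + c₃ - f, 0⟩],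
      fun h0 => hne (congrArg Complex.re (congrFun h0 3)),
      structureOf_eq_of_smul (mul_ne_zero four_ne_zero hne) ?_ ?_⟩
    · simp [spinorNormSq, Fin.sum_univ_four]
      linarith only [h00, h11, h22, h33, h44, h55, p01, p23, p45, h02, h13, h03, h12, p02, p13,
        p03, p12,
        h04, h15, h05, h14, p04, p15, p05, p14, h24, h35, h25, h34, p24, p35, p25, p34]
    · rw [smul_skewMatrix, kleinMatrix]
      congr 1 <;> simp [hermRe, hermIm] <;> first
        | linarith only [h00, h11, h22, h33, h44, h55, p01, p23, p45]
        | linarith only [h02, h13, h03, h12, p02, p13, p03, p12]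
        | linarith only [h04, h15, h05, h14, p04, p15, p05, p14]
        | linarith only [h24, h35, h25, h34, p24, p35, p25, p34]
  by_contra hcon
  have n0 := not_imp_comm.1 col0 hcon
  have n1 := not_imp_comm.1 col1 hcon
  have n2 := not_imp_comm.1 col2 hcon
  have n3 := not_imp_comm.1 col3 hcon
  -- The four diagonal entries add up to 4, so they cannot all vanish.
  linarith

theorem exists_structureOf {J : Matrix (Fin 6) (Fin 6) ℝ} (hJ : J ∈ acs) :
    ∃ u : Fin 4 → ℂ, u ≠ 0 ∧ structureOf u = J :=
  exists_structureOf_eq_skewMatrix (eq_skewMatrix (transpose_of_mem_acs hJ)) hJ.1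
    (pfaffianAdjugate_of_mem_acs hJ)

/-- The bijection from `ℂℙ³` to the space of structures. -/
def kleinEquiv : Projectivization ℂ (Fin 4 → ℂ) ≃ acs :=
  Equiv.ofBijective
    (Projectivization.lift (fun u : { v : Fin 4 → ℂ // v ≠ 0 } =>
        (⟨structureOf u.1, structureOf_mem_acs u.2⟩ : acs)) (by
      rintro ⟨u, hu⟩ ⟨w, hw⟩ c hc
      have hc0 : c ≠ 0 := by
        rintro rfl
        exact hu (by simpa using hc)
      apply Subtype.ext
      change structureOf u = structureOf w
      rw [show u = c • w from hc, structureOf_smul hc0]))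
    (by
      constructor
      · intro p q
        induction p using Projectivization.ind with | h u hu => ?_
        induction q using Projectivization.ind with | h w hw => ?_
        intro h
        exact mk_eq_of_structureOf_eq hu hw (congrArg Subtype.val h)
      · rintro ⟨J, hJ⟩
        obtain ⟨u, hu, rfl⟩ := exists_structureOf hJ
        exact ⟨Projectivization.mk ℂ u hu, rfl⟩)

set_option maxHeartbeats 2000000 in
theorem form_structureOf_single (i : Fin 4) :
    form (structureOf (Pi.single i 1)) = vertexForm i := by
  rw [form_eq_transpose]
  ext k l
  fin_cases i <;> fin_cases k <;> fin_cases l <;>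
    simp [structureOf, kleinMatrix, skewMatrix, hermRe, hermIm, spinorNormSq, Fin.sum_univ_four,
      vertexForm, ee, wedge]

/-! ### The tensor `∇ω` on complex vectors -/

theorem nablaForm_mem_W {J : Matrix (Fin 6) (Fin 6) ℝ} (hJ : J ∈ acs) (p : Coord) :
    nablaForm J p ∈ W J := by
  have hJt := transpose_of_mem_acs hJ
  refine ⟨fun x y z => ?_, fun x y z => ?_⟩
  · rw [nablaForm_apply hJt, nablaForm_apply hJt, koszulForm_swap x z, koszulForm_swap x (J *ᵥ z)]
    ring
  · rw [nablaForm_apply hJt, nablaForm_apply hJt, mulVec_mulVec_of_sq hJ.1,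
      mulVec_mulVec_of_sq hJ.1, ← neg_one_smul ℝ z, ← neg_one_smul ℝ y, koszulForm_smul_right,
      koszulForm_smul_mid]
    ring

/-- The components of `∇ω` in the invariant frame are constant, so one point decides membership. -/
theorem mem_grayHervellaClass {U : Matrix (Fin 6) (Fin 6) ℝ → Submodule ℝ Tensor3}
    {J : Matrix (Fin 6) (Fin 6) ℝ} (hJ : J ∈ acs) :
    J ∈ grayHervellaClass U ↔ nablaForm J 0 ∈ U J := by
  have hconst : ∀ p, nablaForm J p = nablaForm J 0 := fun p => by
    refine LinearMap.ext fun x => LinearMap.ext fun y => LinearMap.ext fun z => ?_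
    rw [nablaForm_apply (transpose_of_mem_acs hJ), nablaForm_apply (transpose_of_mem_acs hJ)]
  constructor
  · intro h
    have := h.2 (proj 1) 1 rfl
    rwa [hconst] at this
  · intro h
    refine ⟨hJ, fun m a _ => ?_⟩
    rw [hconst]
    exact h

/-- A real vector as a complex vector. -/
def toComplex (x : Comp) : Fin 6 → ℂ := fun i => x i

/-- The complex vector `x + i J x`. -/
def holo (J : Matrix (Fin 6) (Fin 6) ℝ) (x : Comp) : Fin 6 → ℂ :=
  toComplex x + Complex.I • toComplex (J *ᵥ x)

theorem koszulForm_toComplex (x y z : Comp) :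
    koszulForm (toComplex x) (toComplex y) (toComplex z) = ((koszulForm x y z : ℝ) : ℂ) := by
  simp [koszulForm, bracketForm, toComplex]

theorem star_holo (J : Matrix (Fin 6) (Fin 6) ℝ) (x : Comp) :
    star (holo J x) = toComplex x + (-Complex.I) • toComplex (J *ᵥ x) := by
  ext i
  simp [holo, toComplex]

/-- Expanding the product of the three vectors `x + i J x` gives eight real terms; the four with an
odd number of factors `J` make up the imaginary part, and they are those of `∇ω(x, y, z) - ∇ω(Jx,
Jy, z)`. Conjugating the first vector reverses the sign of the second tensor, which gives the other
eigencomponent. -/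
theorem antiPart_nablaForm {J : Matrix (Fin 6) (Fin 6) ℝ} (hJ : J ∈ acs) (x y z : Comp) :
    antiPart J (nablaForm J 0) x y z = (koszulForm (holo J x) (holo J y) (holo J z)).im / 4 := by
  have hn : ∀ a b c : Comp, koszulForm a (-b) c = -koszulForm a b c := fun a b c => by
    rw [← neg_one_smul ℝ b, koszulForm_smul_mid, neg_one_mul]
  rw [antiPart_apply, nablaForm_apply (transpose_of_mem_acs hJ),
    nablaForm_apply (transpose_of_mem_acs hJ), mulVec_mulVec_of_sq hJ.1, hn]
  simp only [holo, koszulForm_add_left, koszulForm_add_mid, koszulForm_add_right,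
    koszulForm_smul_left, koszulForm_smul_mid, koszulForm_smul_right, koszulForm_toComplex]
  simp
  ring

theorem symPart_nablaForm {J : Matrix (Fin 6) (Fin 6) ℝ} (hJ : J ∈ acs) (x y z : Comp) :
    symPart J (nablaForm J 0) x y z =
      (koszulForm (star (holo J x)) (holo J y) (holo J z)).im / 4 := by
  have hn : ∀ a b c : Comp, koszulForm a (-b) c = -koszulForm a b c := fun a b c => by
    rw [← neg_one_smul ℝ b, koszulForm_smul_mid, neg_one_mul]
  rw [symPart_apply, nablaForm_apply (transpose_of_mem_acs hJ),
    nablaForm_apply (transpose_of_mem_acs hJ), mulVec_mulVec_of_sq hJ.1, hn, star_holo]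
  simp only [holo, koszulForm_add_left, koszulForm_add_mid, koszulForm_add_right,
    koszulForm_smul_left, koszulForm_smul_mid, koszulForm_smul_right, koszulForm_toComplex]
  simp
  ring

theorem toComplex_vecMul (x : Comp) (J : Matrix (Fin 6) (Fin 6) ℝ) :
    toComplex x ᵥ* J.map Complex.ofReal = toComplex (x ᵥ* J) := by
  ext j
  simp [toComplex, vecMul, dotProduct]

theorem vecMul_of_skew {J : Matrix (Fin 6) (Fin 6) ℝ} (hJt : Jᵀ = -J) (x : Comp) :
    x ᵥ* J = -(J *ᵥ x) := by
  rw [← mulVec_transpose, hJt, neg_mulVec]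

/-- The eigenvalue equation says that the imaginary part of an element of `V_u` is `J` applied to
its real part. -/
theorem exists_kleinWedge_eq_holo {u : Fin 4 → ℂ} (hu : u ≠ 0) (a : Fin 4 → ℂ) :
    ∃ x, holo (structureOf u) x = kleinWedge u a := by
  set J := structureOf u
  have hJt := transpose_of_mem_acs (structureOf_mem_acs hu)
  have h : kleinWedge u a ∈ iEigenspace J := by
    rw [iEigenspace_structureOf hu]
    exact ⟨a, rfl⟩
  have h' : kleinWedge u a ᵥ* J.map Complex.ofReal = Complex.I • kleinWedge u a := h
  generalize kleinWedge u a = α at h'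
  have hα : α = toComplex (fun i => (α i).re) + Complex.I • toComplex (fun i => (α i).im) := by
    ext i
    simp [toComplex, mul_comm Complex.I, Complex.re_add_im]
  refine ⟨fun i => (α i).re, ?_⟩
  rw [hα, add_vecMul, smul_vecMul, toComplex_vecMul, toComplex_vecMul, vecMul_of_skew hJt,
    vecMul_of_skew hJt] at h'
  conv_rhs => rw [hα]
  rw [holo]
  congr 2
  ext j
  have hj := congrArg Complex.re (congrFun h' j)
  simp [toComplex] at hj
  simp [toComplex]
  exact_mod_cast hj

theorem exists_holo_eq_kleinWedge {u : Fin 4 → ℂ} (hu : u ≠ 0) (x : Comp) :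
    ∃ a, kleinWedge u a = holo (structureOf u) x := by
  have hJ := structureOf_mem_acs hu
  have hJt := transpose_of_mem_acs hJ
  have h : holo (structureOf u) x ∈ iEigenspace (structureOf u) := by
    change _ ᵥ* _ = _
    rw [holo, add_vecMul, smul_vecMul, toComplex_vecMul, toComplex_vecMul, vecMul_of_skew hJt,
      vecMul_of_skew hJt, mulVec_mulVec_of_sq hJ.1, neg_neg]
    ext j
    simp [toComplex, mul_add, ← mul_assoc]
    ring
  rw [iEigenspace_structureOf hu] at h
  exact h

theorem kleinWedge_smul (u : Fin 4 → ℂ) (c : ℂ) (a : Fin 4 → ℂ) :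
    kleinWedge u (c • a) = c • kleinWedge u a := by
  ext i
  fin_cases i <;> simp [kleinWedge] <;> ring

/-! ### The Koszul form in the coordinates of `Λ² ℂ⁴` -/

/-- The complex 1-form with coordinates `p = (v⁰¹, v⁰², v⁰³)` and `q = (v²³, v³¹, v¹²)`. -/
def kleinForm (p₁ q₁ p₂ q₂ p₃ q₃ : ℂ) : Fin 6 → ℂ :=
  ![(p₁ + q₁) / 2, Complex.I * (p₁ - q₁) / 2, (p₂ + q₂) / 2, Complex.I * (p₂ - q₂) / 2,
    (p₃ + q₃) / 2, Complex.I * (p₃ - q₃) / 2]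

theorem kleinWedge_eq (u v : Fin 4 → ℂ) :
    kleinWedge u v = kleinForm (u 0 * v 1 - u 1 * v 0) (u 2 * v 3 - u 3 * v 2)
      (u 0 * v 2 - u 2 * v 0) (u 3 * v 1 - u 1 * v 3)
      (u 0 * v 3 - u 3 * v 0) (u 1 * v 2 - u 2 * v 1) := rfl

theorem star_kleinForm (p₁ q₁ p₂ q₂ p₃ q₃ : ℂ) :
    star (kleinForm p₁ q₁ p₂ q₂ p₃ q₃) =
      kleinForm (star q₁) (star p₁) (star q₂) (star p₂) (star q₃) (star p₃) := by
  ext i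
  fin_cases i <;> simp [kleinForm] <;> ring

/-- The Heisenberg bracket is complex-bilinear, so in null coordinates it splits into two conjugate
terms and all mixed products cancel. -/
theorem bracketForm_kleinForm (p₁ q₁ p₂ q₂ p₃ q₃ r₁ s₁ r₂ s₂ r₃ s₃ t₁ w₁ t₂ w₂ t₃ w₃ : ℂ) :
    bracketForm (kleinForm p₁ q₁ p₂ q₂ p₃ q₃) (kleinForm r₁ s₁ r₂ s₂ r₃ s₃)
      (kleinForm t₁ w₁ t₂ w₂ t₃ w₃) =
      -((p₁ * r₂ - p₂ * r₁) * w₃ + (q₁ * s₂ - q₂ * s₁) * t₃) / 2 := by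
  simp only [bracketForm, kleinForm, cons_val]
  linear_combination (((p₁ - q₁) * (r₂ - s₂) - (p₂ - q₂) * (r₁ - s₁)) / 4 * (t₃ + w₃) / 2 -
    ((p₁ + q₁) * (r₂ - s₂) - (p₂ - q₂) * (r₁ + s₁) + (p₁ - q₁) * (r₂ + s₂)
      - (p₂ + q₂) * (r₁ - s₁)) / 4 * (t₃ - w₃) / 2) * Complex.I_sq

theorem dotProduct_kleinForm (p₁ q₁ p₂ q₂ p₃ q₃ r₁ s₁ r₂ s₂ r₃ s₃ : ℂ) :
    kleinForm p₁ q₁ p₂ q₂ p₃ q₃ ⬝ᵥ kleinForm r₁ s₁ r₂ s₂ r₃ s₃ =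
      (p₁ * s₁ + q₁ * r₁ + p₂ * s₂ + q₂ * r₂ + p₃ * s₃ + q₃ * r₃) / 2 := by
  simp only [dotProduct, Fin.sum_univ_six, kleinForm, cons_val]
  linear_combination ((p₁ - q₁) * (r₁ - s₁) + (p₂ - q₂) * (r₂ - s₂) + (p₃ - q₃) * (r₃ - s₃)) / 4 *
    Complex.I_sq

/-- The cyclic sum is alternating on the three-dimensional space `V_u`, hence a multiple of the
volume form `det(u, ·, ·, ·)`; the content is the factor `u₃²`. -/
theorem cyclic_koszulForm_kleinWedge (u a b c : Fin 4 → ℂ) :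
    koszulForm (kleinWedge u a) (kleinWedge u b) (kleinWedge u c) +
      koszulForm (kleinWedge u b) (kleinWedge u c) (kleinWedge u a) +
      koszulForm (kleinWedge u c) (kleinWedge u a) (kleinWedge u b) =
      -(u 3 ^ 2 * (Matrix.of ![u, a, b, c]).det) / 2 := by
  simp only [koszulForm, kleinWedge_eq, bracketForm_kleinForm, Matrix.det_succ_row_zero,
    Fin.sum_univ_succ]
  simp [Fin.succAbove]
  ring

theorem koszulForm_kleinWedge_self (u a c : Fin 4 → ℂ) :
    koszulForm (kleinWedge u a) (kleinWedge u a) (kleinWedge u c) =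
      (u 0 * a 3 - u 3 * a 0) * u 3 * (u 1 * (a 2 * c 3 - a 3 * c 2) - u 2 * (a 1 * c 3 - a 3 * c 1)
        + u 3 * (a 1 * c 2 - a 2 * c 1)) +
      (u 1 * a 2 - u 2 * a 1) * u 0 * (u 0 * (a 1 * c 2 - a 2 * c 1) - u 1 * (a 0 * c 2 - a 2 * c 0)
        + u 2 * (a 0 * c 1 - a 1 * c 0)) := by
  simp only [koszulForm, kleinWedge_eq, bracketForm_kleinForm]
  ring

variable {u : Fin 4 → ℂ}

/-! ### The classes in terms of homogeneous coordinates -/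

theorem structureOf_mem_Z₂₃₄ (hu : u ≠ 0) : structureOf u ∈ Z₂₃₄ ↔ u 3 = 0 := by
  have hJ := structureOf_mem_acs hu
  have hJt := transpose_of_mem_acs hJ
  rw [Z₂₃₄, mem_grayHervellaClass hJ, mem_W₂₃₄_iff hJ.1 hJt (nablaForm_mem_W hJ 0)]
  simp only [antiPart_nablaForm hJ]
  constructor
  · intro h
    have key : ∀ a b c : Fin 4 → ℂ, (u 3 ^ 2 * (Matrix.of ![u, a, b, c]).det).im = 0 := by
      intro a b c
      obtain ⟨x, hx⟩ := exists_kleinWedge_eq_holo hu a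
      obtain ⟨y, hy⟩ := exists_kleinWedge_eq_holo hu b
      obtain ⟨z, hz⟩ := exists_kleinWedge_eq_holo hu c
      have h1 := h x y z
      rw [hx, hy, hz] at h1
      have h2 := congrArg Complex.im (cyclic_koszulForm_kleinWedge u a b c)
      rw [Complex.add_im, Complex.add_im, neg_div, Complex.neg_im] at h2
      have h3 : (u 3 ^ 2 * (Matrix.of ![u, a, b, c]).det / 2).im = 0 := by linarith
      simpa using h3
    -- The values `t = 1` and `t = i` recover both parts of `u₃³` from a condition on imaginary
    -- parts only.
    have hdet : ∀ t : ℂ, (Matrix.of ![u, Pi.single 0 t, Pi.single 1 1, Pi.single 2 1]).det =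
        -(u 3 * t) := by
      intro t
      simp [Matrix.det_succ_row_zero, Fin.sum_univ_succ, Fin.succAbove]
      ring
    have h1 := key (Pi.single 0 1) (Pi.single 1 1) (Pi.single 2 1)
    have h2 := key (Pi.single 0 Complex.I) (Pi.single 1 1) (Pi.single 2 1)
    rw [hdet] at h1 h2
    have h3 : u 3 ^ 3 = 0 := by
      apply Complex.ext
      · rw [show u 3 ^ 2 * -(u 3 * Complex.I) = -(u 3 ^ 3 * Complex.I) by ring, Complex.neg_im,
          Complex.mul_I_im] at h2
        simpa using h2
      · rw [show u 3 ^ 2 * -(u 3 * 1) = -(u 3 ^ 3) by ring, Complex.neg_im] at h1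
        simpa using h1
    exact pow_eq_zero_iff (three_ne_zero) |>.1 h3
  · intro h x y z
    obtain ⟨a, ha⟩ := exists_holo_eq_kleinWedge hu x
    obtain ⟨b, hb⟩ := exists_holo_eq_kleinWedge hu y
    obtain ⟨c, hc⟩ := exists_holo_eq_kleinWedge hu z
    have h2 := congrArg Complex.im (cyclic_koszulForm_kleinWedge u a b c)
    rw [h, Complex.add_im, Complex.add_im] at h2
    simp at h2
    rw [← ha, ← hb, ← hc]
    linarith

theorem structureOf_mem_Z₁₃₄ (hu : u ≠ 0) : structureOf u ∈ Z₁₃₄ ↔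
    (u 1 = 0 ∧ u 2 = 0 ∧ u 3 = 0) ∨ (u 0 = 0 ∧ u 3 = 0) := by
  have hJ := structureOf_mem_acs hu
  have hJt := transpose_of_mem_acs hJ
  rw [Z₁₃₄, mem_grayHervellaClass hJ, mem_W₁₃₄_iff hJ.1 hJt (nablaForm_mem_W hJ 0)]
  simp only [antiPart_nablaForm hJ]
  constructor
  · intro h
    have key' : ∀ a c : Fin 4 → ℂ,
        (koszulForm (kleinWedge u a) (kleinWedge u a) (kleinWedge u c)).im = 0 := by
      intro a c
      obtain ⟨x, hx⟩ := exists_kleinWedge_eq_holo hu a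
      obtain ⟨z, hz⟩ := exists_kleinWedge_eq_holo hu c
      have h1 := h x z
      rw [hx, hz] at h1
      linarith
    have key : ∀ a c : Fin 4 → ℂ,
        koszulForm (kleinWedge u a) (kleinWedge u a) (kleinWedge u c) = 0 := by
      intro a c
      have h1 := key' a (Complex.I • c)
      rw [kleinWedge_smul, koszulForm_smul_right, Complex.I_mul_im] at h1
      exact Complex.ext h1 (key' a c)
    simp only [koszulForm_kleinWedge_self] at key
    -- This choice of `a` makes `u₁ a₂ - u₂ a₁` vanish, which kills the second term. If `u₃ ≠ 0`,
    -- then `k1` and `k2` give `u₂ = u₁ = 0`, and `k3` becomes `u₃³ = 0`. If `u₃ = 0`, then `k4` and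
    -- `k5` give `u₀² u₂ = u₀² u₁ = 0`.
    have k1 := key ![1, u 1, u 2, 0] (Pi.single 1 1)
    have k2 := key ![1, u 1, u 2, 0] (Pi.single 2 1)
    have k3 := key ![1, 1, 0, 0] (Pi.single 2 1)
    have k4 := key (Pi.single 1 1) (Pi.single 2 1)
    have k5 := key (Pi.single 2 1) (Pi.single 1 1)
    clear key key' h
    by_cases h3 : u 3 = 0
    · simp [h3] at k4 k5
      by_cases h0 : u 0 = 0
      · exact Or.inr ⟨h0, h3⟩
      · simp [h0] at k4 k5
        exact Or.inl ⟨k5, k4, h3⟩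
    · exfalso
      simp at k1 k2 k3 k4 k5
      simp only [mul_comm (u 2) (u 1), sub_self, zero_mul, add_zero] at k1 k2
      simp_all
  · rintro h x z
    obtain ⟨a, ha⟩ := exists_holo_eq_kleinWedge hu x
    obtain ⟨c, hc⟩ := exists_holo_eq_kleinWedge hu z
    rw [← ha, ← hc, koszulForm_kleinWedge_self]
    rcases h with ⟨h1, h2, h3⟩ | ⟨h0, h3⟩
    · simp [h1, h2, h3]
    · simp [h0, h3]

theorem hermRe_eq_zero_and_hermIm_eq_zero_iff (i j : Fin 4) :
    hermRe u i j = 0 ∧ hermIm u i j = 0 ↔ u i = 0 ∨ u j = 0 := by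
  have h : u i * star (u j) = ⟨hermRe u i j, hermIm u i j⟩ := by
    apply Complex.ext
    · simp [hermRe]
    · simp [hermIm]
      ring
  rw [show (u i = 0 ∨ u j = 0) ↔ u i * star (u j) = 0 by simp, h]
  exact (Complex.ext_iff (z := ⟨hermRe u i j, hermIm u i j⟩) (w := 0)).symm

theorem trace₁₂_nablaForm {J : Matrix (Fin 6) (Fin 6) ℝ} (hJ : J ∈ acs) (z : Comp) :
    trace₁₂ (nablaForm J 0) z = (J 0 2 - J 1 3) * z 4 + (J 0 3 + J 1 2) * z 5 := by
  have hJt := transpose_of_mem_acs hJ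
  rw [trace₁₂_apply, Fin.sum_univ_six]
  simp only [nablaForm_apply hJt]
  rw [eq_skewMatrix hJt]
  simp [koszulForm, bracketForm, mulVec, dotProduct, Fin.sum_univ_six, skewMatrix, Pi.single_apply]
  ring

theorem structureOf_mem_Z₁₂₃ (hu : u ≠ 0) : structureOf u ∈ Z₁₂₃ ↔ u 0 = 0 ∨ u 3 = 0 := by
  have hJ := structureOf_mem_acs hu
  have hJt := transpose_of_mem_acs hJ
  have hn := (spinorNormSq_pos hu).ne'
  rw [Z₁₂₃, mem_grayHervellaClass hJ, mem_W₁₂₃_iff hJ.1 hJt (nablaForm_mem_W hJ 0),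
    ← hermRe_eq_zero_and_hermIm_eq_zero_iff]
  have h1 : structureOf u 0 2 - structureOf u 1 3 = (spinorNormSq u)⁻¹ * (4 * hermIm u 0 3) := by
    simp [structureOf, kleinMatrix, skewMatrix]
    ring
  have h2 : structureOf u 0 3 + structureOf u 1 2 = (spinorNormSq u)⁻¹ * (4 * hermRe u 0 3) := by
    simp [structureOf, kleinMatrix, skewMatrix]
    ring
  simp only [trace₁₂_nablaForm hJ, h1, h2]
  constructor
  · intro h
    have h4 := h (Pi.single 4 1)
    have h5 := h (Pi.single 5 1)
    simp [hn] at h4 h5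
    exact ⟨h5, h4⟩
  · rintro ⟨h, h'⟩ z
    simp [h, h']

theorem cyclic_nablaForm {J : Matrix (Fin 6) (Fin 6) ℝ} (hJ : J ∈ acs) (x y z : Comp) :
    nablaForm J 0 x y z + nablaForm J 0 y z x + nablaForm J 0 z x y =
      bracketForm x y (J *ᵥ z) + bracketForm y z (J *ᵥ x) + bracketForm z x (J *ᵥ y) := by
  simp only [nablaForm_apply (transpose_of_mem_acs hJ), koszulForm, bracketForm]
  ring

/-- Membership in `𝒲₂` is the vanishing of the cyclic sum of `∇ω`, that is, `dω = 0`. Only the parts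
of `ω` containing `e⁵` or `e⁶` contribute to `dω`. -/
theorem mem_Z₂_iff {J : Matrix (Fin 6) (Fin 6) ℝ} (hJ : J ∈ acs) : J ∈ Z₂ ↔
    J 4 5 = 0 ∧ J 0 4 + J 1 5 = 0 ∧ J 1 4 - J 0 5 = 0 ∧ J 2 4 + J 3 5 = 0 ∧ J 3 4 - J 2 5 = 0 := by
  have hJt := transpose_of_mem_acs hJ
  have hs : ∀ i j, J j i = -J i j := fun i j => congrFun (congrFun hJt i) j
  have hmem : J ∈ Z₂ ↔ ∀ x y z : Comp,
      bracketForm x y (J *ᵥ z) + bracketForm y z (J *ᵥ x) + bracketForm z x (J *ᵥ y) = 0 := by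
    rw [Z₂, mem_grayHervellaClass hJ]
    simp only [← cyclic_nablaForm hJ]
    exact ⟨fun h => h.2, fun h => ⟨nablaForm_mem_W hJ 0, h⟩⟩
  rw [hmem]
  constructor
  · intro h
    have k1 := h (Pi.single 0 1) (Pi.single 2 1) (Pi.single 5 1)
    have k2 := h (Pi.single 0 1) (Pi.single 2 1) (Pi.single 1 1)
    have k3 := h (Pi.single 0 1) (Pi.single 2 1) (Pi.single 3 1)
    have k4 := h (Pi.single 1 1) (Pi.single 3 1) (Pi.single 0 1)
    have k5 := h (Pi.single 1 1) (Pi.single 3 1) (Pi.single 2 1)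
    simp [bracketForm] at k1 k2 k3 k4 k5
    rw [hs 0 4, hs 1 5] at k4
    rw [hs 2 4, hs 3 5] at k5
    rw [hs 1 4, hs 0 5] at k2
    rw [hs 3 4, hs 2 5] at k3
    refine ⟨k1, ?_, ?_, ?_, ?_⟩ <;> linarith
  · rintro ⟨h1, h2, h3, h4, h5⟩ x y z
    have e1 : J 1 5 = -J 0 4 := by linarith
    have e2 : J 0 5 = J 1 4 := by linarith
    have e3 : J 3 5 = -J 2 4 := by linarith
    have e4 : J 2 5 = J 3 4 := by linarith
    have hd : ∀ i, J i i = 0 := fun i => by linarith [hs i i]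
    simp only [bracketForm, mulVec, dotProduct, Fin.sum_univ_six, hs 0 4, hs 1 4, hs 2 4, hs 3 4,
      hs 4 5, hs 0 5, hs 1 5, hs 2 5, hs 3 5, hd, h1, e1, e2, e3, e4]
    ring

theorem structureOf_mem_Z₂ (hu : u ≠ 0) : structureOf u ∈ Z₂ ↔
    u 3 = 0 ∧ hermRe u 0 0 = hermRe u 1 1 + hermRe u 2 2 := by
  have hn := (spinorNormSq_pos hu).ne'
  have e1 : structureOf u 4 5 = (spinorNormSq u)⁻¹ *
      (-hermRe u 0 0 - hermRe u 3 3 + hermRe u 1 1 + hermRe u 2 2) := by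
    simp [structureOf, kleinMatrix, skewMatrix]
  have e2 : structureOf u 0 4 + structureOf u 1 5 = (spinorNormSq u)⁻¹ * (4 * hermIm u 1 3) := by
    simp [structureOf, kleinMatrix, skewMatrix]
    ring
  have e3 : structureOf u 1 4 - structureOf u 0 5 = (spinorNormSq u)⁻¹ * (4 * hermRe u 1 3) := by
    simp [structureOf, kleinMatrix, skewMatrix]
    ring
  have e4 : structureOf u 2 4 + structureOf u 3 5 = (spinorNormSq u)⁻¹ * (4 * hermIm u 2 3) := by
    simp [structureOf, kleinMatrix, skewMatrix]
    ring
  have e5 : structureOf u 3 4 - structureOf u 2 5 = (spinorNormSq u)⁻¹ * (4 * hermRe u 2 3) := by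
    simp [structureOf, kleinMatrix, skewMatrix]
    ring
  rw [mem_Z₂_iff (structureOf_mem_acs hu), e1, e2, e3, e4, e5]
  simp only [mul_eq_zero, inv_eq_zero, hn, false_or, OfNat.ofNat_ne_zero]
  constructor
  · rintro ⟨h1, h2, h3, h4, h5⟩
    have h13 := (hermRe_eq_zero_and_hermIm_eq_zero_iff 1 3).1 ⟨h3, h2⟩
    have h23 := (hermRe_eq_zero_and_hermIm_eq_zero_iff 2 3).1 ⟨h5, h4⟩
    -- Otherwise `u₁ = u₂ = 0`, and the vanishing of `J 4 5` would give `|u₀|² + |u₃|² = 0`.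
    have hu3 : u 3 = 0 := by
      by_contra h
      have hu1 := h13.resolve_right h
      have hu2 := h23.resolve_right h
      have hz : hermRe u 1 1 = 0 ∧ hermRe u 2 2 = 0 := by simp [hermRe, hu1, hu2]
      have hu3 := spinorNormSq_pos hu
      rw [spinorNormSq_eq] at hu3
      linarith
    refine ⟨hu3, ?_⟩
    have : hermRe u 3 3 = 0 := by simp [hermRe, hu3]
    linarith
  · rintro ⟨h3, h⟩
    have h33 := (hermRe_eq_zero_and_hermIm_eq_zero_iff (u := u) 3 3).2 (Or.inl h3)
    have h13 := (hermRe_eq_zero_and_hermIm_eq_zero_iff (u := u) 1 3).2 (Or.inr h3)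
    have h23 := (hermRe_eq_zero_and_hermIm_eq_zero_iff (u := u) 2 3).2 (Or.inr h3)
    exact ⟨by linarith, h13.2, h13.1, h23.2, h23.1⟩

/-- The conjugate of the complex 1-form `v̄ ∧ x̄`. -/
def conjWedge (v x : Fin 4 → ℂ) : Fin 6 → ℂ :=
  kleinForm (v 2 * x 3 - v 3 * x 2) (v 0 * x 1 - v 1 * x 0) (v 3 * x 1 - v 1 * x 3)
    (v 0 * x 2 - v 2 * x 0) (v 1 * x 2 - v 2 * x 1) (v 0 * x 3 - v 3 * x 0)

theorem star_kleinWedge_star (u x : Fin 4 → ℂ) :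
    star (kleinWedge u (star x)) = conjWedge (star u) x := by
  simp only [kleinWedge_eq, star_kleinForm, conjWedge, star_sub, star_mul', Pi.star_apply,
    star_star]

theorem conjWedge_dotProduct_kleinWedge (v x u b : Fin 4 → ℂ) :
    conjWedge v x ⬝ᵥ kleinWedge u b = ((v ⬝ᵥ u) * (x ⬝ᵥ b) - (v ⬝ᵥ b) * (x ⬝ᵥ u)) / 2 := by
  rw [conjWedge, kleinWedge_eq, dotProduct_kleinForm]
  simp only [dotProduct, Fin.sum_univ_four]
  ring

/-- The first vector `x` is the general solution of `x · u = 0` when `u₃ ≠ 0`, and `(t₁, -t₀, 0,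
0)`, `(t₂, 0, -t₀, 0)` are annihilated by `x`. These are the inputs required by
`koszulForm_eq_zero_of_mem_Z₁₂₄`. -/
theorem koszulForm_conjWedge (v u : Fin 4 → ℂ) (t₀ t₁ t₂ : ℂ) :
    koszulForm (conjWedge v ![u 3 * t₀, u 3 * t₁, u 3 * t₂, -(u 0 * t₀ + u 1 * t₁ + u 2 * t₂)])
      (kleinWedge u ![t₁, -t₀, 0, 0]) (kleinWedge u ![t₂, 0, -t₀, 0]) = -t₀ / 2 *
      ((u 0 * v 0 + u 3 * v 3 - u 1 * v 1 - u 2 * v 2) * (u 0 * t₀ + u 1 * t₁ + u 2 * t₂) ^ 2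
        + 2 * u 3 ^ 3 * t₀ * (t₁ * v 2 - t₂ * v 1)
        - 2 * (u 0 * t₀ + u 1 * t₁ + u 2 * t₂) * v 3 * u 3 * (u 1 * t₁ + u 2 * t₂)) := by
  simp only [koszulForm, conjWedge, kleinWedge_eq, bracketForm_kleinForm, cons_val]
  ring

theorem koszulForm_conjWedge_single (v u b c : Fin 4 → ℂ) (hu : u 3 = 0) (hb : b 3 = 0)
    (hc : c 3 = 0) :
    koszulForm (conjWedge v (Pi.single 3 1)) (kleinWedge u b) (kleinWedge u c) =
      (u 0 * v 0 - u 1 * v 1 - u 2 * v 2) / 2 * (u 0 * (b 1 * c 2 - b 2 * c 1)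
        - u 1 * (b 0 * c 2 - b 2 * c 0) + u 2 * (b 0 * c 1 - b 1 * c 0)) := by
  simp [koszulForm, conjWedge, kleinWedge_eq, bracketForm_kleinForm, hu, hb, hc]
  ring

/-- The conditions on `x` make the conjugate vector orthogonal to `u ∧ b` and `u ∧ c`. In real terms
`p` is orthogonal to `q`, `Jq`, `r`, `Jr`, so all four terms of a `𝒲₄` tensor vanish for every `θ`.
-/
theorem koszulForm_eq_zero_of_mem_Z₁₂₄ (hu : u ≠ 0) (h : structureOf u ∈ Z₁₂₄)
    {x b c : Fin 4 → ℂ} (hxu : x ⬝ᵥ u = 0) (hxb : x ⬝ᵥ b = 0) (hxc : x ⬝ᵥ c = 0) :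
    koszulForm (conjWedge (star u) x) (kleinWedge u b) (kleinWedge u c) = 0 := by
  have hJ := structureOf_mem_acs hu
  have hJt := transpose_of_mem_acs hJ
  rw [Z₁₂₄, mem_grayHervellaClass hJ] at h
  obtain ⟨θ, hθ⟩ := exists_symPart_eq_pureTrace hJ.1 hJt h
  simp only [symPart_nablaForm hJ] at hθ
  have key : ∀ b : Fin 4 → ℂ, x ⬝ᵥ b = 0 →
      (koszulForm (conjWedge (star u) x) (kleinWedge u b) (kleinWedge u c)).im = 0 := by
    intro b hxb
    obtain ⟨p, hp⟩ := exists_kleinWedge_eq_holo hu (star x)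
    obtain ⟨q, hq⟩ := exists_kleinWedge_eq_holo hu b
    obtain ⟨r, hr⟩ := exists_kleinWedge_eq_holo hu c
    have orth : ∀ q : Comp, star (holo (structureOf u) p) ⬝ᵥ holo (structureOf u) q = 0 →
        p ⬝ᵥ q = 0 ∧ p ⬝ᵥ (structureOf u *ᵥ q) = 0 := by
      intro q hq
      have hc : ∀ y w : Comp, toComplex y ⬝ᵥ toComplex w = ((y ⬝ᵥ w : ℝ) : ℂ) := fun y w => by
        simp [toComplex, dotProduct]
      have hJJ : (structureOf u *ᵥ p) ⬝ᵥ (structureOf u *ᵥ q) = p ⬝ᵥ q := by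
        rw [dotProduct_mulVec_of_skew hJt, mulVec_mulVec_of_sq hJ.1, neg_dotProduct, neg_neg]
      rw [star_holo, holo, add_dotProduct, dotProduct_add, dotProduct_add, smul_dotProduct,
        smul_dotProduct, dotProduct_smul, dotProduct_smul, hc, hc, hc, hc, hJJ] at hq
      have h1 := congrArg Complex.re hq
      have h2 := congrArg Complex.im hq
      rw [show (structureOf u *ᵥ p) ⬝ᵥ q = -(p ⬝ᵥ (structureOf u *ᵥ q)) by
        rw [dotProduct_mulVec_of_skew hJt, neg_neg]] at h1 h2
      simp at h1 h2
      constructor <;> linarith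
    have hs : star (holo (structureOf u) p) = conjWedge (star u) x := by
      rw [hp, star_kleinWedge_star]
    have oq := orth q (by
      rw [hs, hq, conjWedge_dotProduct_kleinWedge, hxu, hxb]
      ring)
    have or := orth r (by
      rw [hs, hr, conjWedge_dotProduct_kleinWedge, hxu, hxc]
      ring)
    have hz := hθ p q r
    rw [hs, hq, hr, pureTrace, oq.1, oq.2, or.1, or.2] at hz
    linarith
  have h1 := key b hxb
  have h2 := key (Complex.I • b) (by rw [dotProduct_smul, hxb, smul_zero])
  rw [kleinWedge_smul, koszulForm_smul_mid, Complex.I_mul_im] at h2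
  exact Complex.ext h2 h1

theorem Z₂_subset_Z₁₂₄ : Z₂ ⊆ Z₁₂₄ := fun _ h =>
  ⟨h.1, fun m a ha => Submodule.mem_sup_left (Submodule.mem_sup_right (h.2 m a ha))⟩

theorem structureOf_mem_Z₁₂₄ (hu : u ≠ 0) : structureOf u ∈ Z₁₂₄ ↔
    (u 0 = 0 ∧ u 1 = 0 ∧ u 2 = 0) ∨ (u 3 = 0 ∧ hermRe u 0 0 = hermRe u 1 1 + hermRe u 2 2) := by
  have hJ := structureOf_mem_acs hu
  have hJt := transpose_of_mem_acs hJ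
  have hr : ∀ i, u i * star (u i) = (hermRe u i i : ℂ) := fun i => by
    apply Complex.ext
    · simp [hermRe]
    · simp
      ring
  have hr0 : ∀ i, 0 ≤ hermRe u i i := fun i => add_nonneg (mul_self_nonneg _) (mul_self_nonneg _)
  have hz : ∀ i, hermRe u i i = 0 → u i = 0 := fun i hi => by
    have := hr i
    rw [hi] at this
    simpa using this
  constructor
  · intro h
    by_cases h3 : u 3 = 0
    · right
      refine ⟨h3, ?_⟩
      have key : ∀ b c : Fin 4 → ℂ, b 3 = 0 → c 3 = 0 →
          (u 0 * star u 0 - u 1 * star u 1 - u 2 * star u 2) * (u 0 * (b 1 * c 2 - b 2 * c 1)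
            - u 1 * (b 0 * c 2 - b 2 * c 0) + u 2 * (b 0 * c 1 - b 1 * c 0)) = 0 := by
        intro b c hb hc
        have hk := koszulForm_eq_zero_of_mem_Z₁₂₄ hu h (x := Pi.single 3 1) (b := b) (c := c)
          (by simp [h3]) (by simp [hb]) (by simp [hc])
        rw [koszulForm_conjWedge_single _ _ _ _ h3 hb hc] at hk
        linear_combination 2 * hk
      have k0 := key (Pi.single 1 1) (Pi.single 2 1) (by simp) (by simp)
      have k1 := key (Pi.single 0 1) (Pi.single 2 1) (by simp) (by simp)
      have k2 := key (Pi.single 0 1) (Pi.single 1 1) (by simp) (by simp)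
      simp only [Pi.star_apply, hr] at k0 k1 k2
      simp at k0 k1 k2
      have hs : (hermRe u 0 0 : ℂ) - hermRe u 1 1 - hermRe u 2 2 = 0 := by
        by_contra hs
        refine hu (funext fun i => ?_)
        fin_cases i
        · exact k0.resolve_left hs
        · exact k1.resolve_left hs
        · exact k2.resolve_left hs
        · exact h3
      have : hermRe u 0 0 - hermRe u 1 1 - hermRe u 2 2 = 0 := by exact_mod_cast hs
      linarith
    · left
      have key : ∀ t₁ t₂ : ℂ,
          (hermRe u 0 0 + hermRe u 3 3 - hermRe u 1 1 - hermRe u 2 2 : ℂ) *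
              (u 0 + u 1 * t₁ + u 2 * t₂) ^ 2
            + 2 * u 3 ^ 3 * (t₁ * star (u 2) - t₂ * star (u 1))
            - 2 * (u 0 + u 1 * t₁ + u 2 * t₂) * hermRe u 3 3 * (u 1 * t₁ + u 2 * t₂) = 0 := by
        intro t₁ t₂
        have hk := koszulForm_eq_zero_of_mem_Z₁₂₄ hu h
          (x := ![u 3 * 1, u 3 * t₁, u 3 * t₂, -(u 0 * 1 + u 1 * t₁ + u 2 * t₂)])
          (b := ![t₁, -1, 0, 0]) (c := ![t₂, 0, -1, 0])
          (by simp [dotProduct, Fin.sum_univ_four]; ring)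
          (by simp [dotProduct, Fin.sum_univ_four])
          (by simp [dotProduct, Fin.sum_univ_four])
        rw [koszulForm_conjWedge] at hk
        simp only [Pi.star_apply] at hk
        simp only [← hr]
        linear_combination (-2) * hk
      have k0 := key 0 0
      have k1 := key 1 0
      have k1' := key (-1) 0
      have k2 := key 0 1
      have k2' := key 0 (-1)
      -- The differences `k1 - k1'` and `k2 - k2'` isolate the parts odd in `t₁` and `t₂`. Weighting
      -- them by `u₂` and `-u₁` cancels every term with a factor `u₀` and leaves `u₃³ (|u₁|² +
      -- |u₂|²)`.
      have k12 : u 3 ^ 3 * ((hermRe u 1 1 + hermRe u 2 2 : ℝ) : ℂ) = 0 := by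
        push_cast
        rw [← hr 1, ← hr 2]
        linear_combination (u 2 / 4) * (k1 - k1') - (u 1 / 4) * (k2 - k2')
      have k12' : hermRe u 1 1 + hermRe u 2 2 = 0 := by
        have := (mul_eq_zero.1 k12).resolve_left (pow_ne_zero _ h3)
        exact_mod_cast this
      have h1 : hermRe u 1 1 = 0 := by linarith [hr0 1, hr0 2]
      have h2 : hermRe u 2 2 = 0 := by linarith [hr0 1, hr0 2]
      have h33 : 0 < hermRe u 3 3 := (hr0 3).lt_of_ne fun h => h3 (hz 3 h.symm)
      refine ⟨?_, hz 1 h1, hz 2 h2⟩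
      have hne : (hermRe u 0 0 + hermRe u 3 3 : ℂ) ≠ 0 := by
        have : hermRe u 0 0 + hermRe u 3 3 ≠ 0 := by linarith [hr0 0]
        exact_mod_cast this
      simp [h1, h2] at k0
      exact k0.resolve_left hne
  · rintro (⟨h0, h1, h2⟩ | h)
    · rw [Z₁₂₄, mem_grayHervellaClass hJ]
      refine Submodule.mem_sup_left (mem_W₁_sup_W₂ hJ.1 (nablaForm_mem_W hJ 0) fun x y z => ?_)
      have hs := symPart_nablaForm hJ x y z
      obtain ⟨a, ha⟩ := exists_holo_eq_kleinWedge hu x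
      obtain ⟨b, hb⟩ := exists_holo_eq_kleinWedge hu y
      obtain ⟨c, hc⟩ := exists_holo_eq_kleinWedge hu z
      rw [← ha, ← hb, ← hc, ← star_star a, star_kleinWedge_star] at hs
      have hk : koszulForm (conjWedge (star u) (star a)) (kleinWedge u b) (kleinWedge u c) = 0 := by
        simp [koszulForm, conjWedge, kleinWedge_eq, bracketForm_kleinForm, h0, h1, h2]
      rw [hk, symPart_apply] at hs
      simp at hs
      linarith
    · exact Z₂_subset_Z₁₂₄ ((structureOf_mem_Z₂ hu).2 h)

/-! ### The sphere of almost Kähler structures -/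

/-- The structure with fundamental form
`e⁵ ∧ x + Ix ∧ e⁶ + (e¹² + e³⁴ - x ∧ Ix)`, where `I` rotates the planes `e¹², e³⁴`. -/
def sphereMatrix (x : Fin 4 → ℝ) : Matrix (Fin 6) (Fin 6) ℝ :=
  skewMatrix (x 0 ^ 2 + x 1 ^ 2 - 1) (x 1 * x 2 - x 0 * x 3) (x 0 * x 2 + x 1 * x 3) (x 0) (x 1)
    (-(x 0 * x 2 + x 1 * x 3)) (x 1 * x 2 - x 0 * x 3) (x 1) (-x 0)
    (x 2 ^ 2 + x 3 ^ 2 - 1) (x 2) (x 3)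
    (x 3) (-x 2)
    0

/-- The homogeneous coordinates of `sphereMatrix x`. -/
def sphereSpinor (x : Fin 4 → ℝ) : Fin 4 → ℂ := ![1, ⟨x 3, -x 2⟩, ⟨-x 1, x 0⟩, 0]

theorem sphereSpinor_ne_zero (x : Fin 4 → ℝ) : sphereSpinor x ≠ 0 := fun h =>
  one_ne_zero (congrFun h 0)

theorem structureOf_sphereSpinor {x : Fin 4 → ℝ} (hx : x 0 ^ 2 + x 1 ^ 2 + x 2 ^ 2 + x 3 ^ 2 = 1) :
    structureOf (sphereSpinor x) = sphereMatrix x := by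
  refine structureOf_eq_of_smul two_ne_zero ?_ ?_
  · simp [spinorNormSq, Fin.sum_univ_four, sphereSpinor]
    linarith
  · rw [sphereMatrix, smul_skewMatrix, kleinMatrix]
    congr 1 <;> simp [hermRe, hermIm, sphereSpinor] <;> linarith

theorem mem_Z₂_iff_exists_sphereMatrix {J : Matrix (Fin 6) (Fin 6) ℝ} : J ∈ Z₂ ↔
    ∃ x : Fin 4 → ℝ, x 0 ^ 2 + x 1 ^ 2 + x 2 ^ 2 + x 3 ^ 2 = 1 ∧ sphereMatrix x = J := by
  constructor
  · intro h
    obtain ⟨u, hu, rfl⟩ := exists_structureOf h.1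
    obtain ⟨h3, hn⟩ := (structureOf_mem_Z₂ hu).1 h
    have h0 : u 0 ≠ 0 := by
      intro h0
      have := spinorNormSq_pos hu
      rw [spinorNormSq_eq] at this
      have h00 : hermRe u 0 0 = 0 := by simp [hermRe, h0]
      have h33 : hermRe u 3 3 = 0 := by simp [hermRe, h3]
      linarith
    -- The scaling `u₀ = 1` leaves no freedom in `u` and turns the norm condition into `|u₁|² +
    -- |u₂|² = 1`.
    set w := (u 0)⁻¹ • u with hw
    have hw0 : w 0 = 1 := by simp [hw, h0]
    have hw3 : w 3 = 0 := by simp [hw, h3]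
    have hwu : structureOf w = structureOf u := structureOf_smul (inv_ne_zero h0) u
    have hwne : w ≠ 0 := smul_ne_zero (inv_ne_zero h0) hu
    rw [← hwu] at h ⊢
    have hn' := ((structureOf_mem_Z₂ hwne).1 h).2
    simp [hermRe, hw0] at hn'
    have hx : w = sphereSpinor ![(w 2).im, -(w 2).re, -(w 1).im, (w 1).re] := by
      ext i
      fin_cases i <;> simp [sphereSpinor, hw0, hw3]
    have hx1 : (w 2).im ^ 2 + (-(w 2).re) ^ 2 + (-(w 1).im) ^ 2 + (w 1).re ^ 2 = 1 := by linarith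
    refine ⟨![(w 2).im, -(w 2).re, -(w 1).im, (w 1).re], hx1, ?_⟩
    rw [← structureOf_sphereSpinor hx1, ← hx]
  · rintro ⟨x, hx, rfl⟩
    rw [← structureOf_sphereSpinor hx, structureOf_mem_Z₂ (sphereSpinor_ne_zero x)]
    simp [sphereSpinor, hermRe]
    linarith

/-- The element of `SO(4)`, commuting with the rotation of the planes `e¹², e³⁴`, with first
column `x`. -/
def sphereRotation (x : Fin 4 → ℝ) : Matrix (Fin 4) (Fin 4) ℝ :=
  !![x 0, -x 1, -x 2, -x 3; x 1, x 0, x 3, -x 2; x 2, -x 3, x 0, x 1; x 3, x 2, -x 1, x 0]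

theorem sphereRotation_mem {x : Fin 4 → ℝ} (hx : x 0 ^ 2 + x 1 ^ 2 + x 2 ^ 2 + x 3 ^ 2 = 1) :
    sphereRotation x ∈ Matrix.specialOrthogonalGroup (Fin 4) ℝ := by
  rw [Matrix.mem_specialOrthogonalGroup_iff]
  constructor
  · rw [Matrix.mem_orthogonalGroup_iff]
    ext i j
    fin_cases i <;> fin_cases j <;>
      simp [sphereRotation, Matrix.mul_apply, Fin.sum_univ_four] <;> linarith
  · have : (sphereRotation x).det = (x 0 ^ 2 + x 1 ^ 2 + x 2 ^ 2 + x 3 ^ 2) ^ 2 := by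
      simp [sphereRotation, Matrix.det_succ_row_zero, Fin.sum_univ_succ, Fin.succAbove]
      ring
    rw [this, hx, one_pow]

theorem selfDualEntry_eq (P : Matrix (Fin 4) (Fin 4) ℝ) :
    selfDualEntry P = ((P 0 0 * P 1 1 - P 1 0 * P 0 1 + (P 0 2 * P 1 3 - P 1 2 * P 0 3)) +
      (P 2 0 * P 3 1 - P 3 0 * P 2 1 + (P 2 2 * P 3 3 - P 3 2 * P 2 3))) / 2 := by
  simp [selfDualEntry, wedge, ee, rotated, Fin.sum_univ_six]
  ring

theorem paramForm_zero_one (P : Matrix (Fin 4) (Fin 4) ℝ) :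
    paramForm P 0 1 =
      let m : Fin 4 → Fin 4 → ℝ := fun i j => P i 2 * P j 3 - P j 2 * P i 3
      skewMatrix (m 0 1) (m 0 2) (m 0 3) (-P 0 0) (P 0 1) (m 1 2) (m 1 3) (-P 1 0) (P 1 1)
        (m 2 3) (-P 2 0) (P 2 1) (-P 3 0) (P 3 1) 0 := by
  ext i j
  fin_cases i <;> fin_cases j <;> simp [paramForm, wedge, rotated, skewMatrix]

theorem form_sphereMatrix (x : Fin 4 → ℝ) : form (sphereMatrix x) = skewMatrix
    (1 - x 0 ^ 2 - x 1 ^ 2) (x 0 * x 3 - x 1 * x 2) (-(x 0 * x 2 + x 1 * x 3)) (-x 0) (-x 1)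
    (x 0 * x 2 + x 1 * x 3) (x 0 * x 3 - x 1 * x 2) (-x 1) (x 0)
    (1 - x 2 ^ 2 - x 3 ^ 2) (-x 2) (-x 3)
    (-x 3) (x 2)
    0 := by
  rw [form_eq_transpose]
  ext i j
  fin_cases i <;> fin_cases j <;> simp [sphereMatrix, skewMatrix] <;> ring

theorem eq_of_sum_sq_eq_two {a b c d e f : ℝ}
    (h : a ^ 2 + b ^ 2 + c ^ 2 + d ^ 2 + e ^ 2 + f ^ 2 = 2)
    (h' : a + f = 2) : a = 1 ∧ b = 0 ∧ c = 0 ∧ d = 0 ∧ e = 0 ∧ f = 1 := by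
  have hs : (a - 1) ^ 2 + b ^ 2 + c ^ 2 + d ^ 2 + e ^ 2 + (f - 1) ^ 2 = 0 := by
    linear_combination h - 2 * h'
  have ha := sq_nonneg (a - 1)
  have hb := sq_nonneg b
  have hc := sq_nonneg c
  have hd := sq_nonneg d
  have he := sq_nonneg e
  have hf := sq_nonneg (f - 1)
  refine ⟨sub_eq_zero.1 (pow_eq_zero_iff two_ne_zero |>.1 ?_),
    pow_eq_zero_iff two_ne_zero |>.1 ?_, pow_eq_zero_iff two_ne_zero |>.1 ?_,
    pow_eq_zero_iff two_ne_zero |>.1 ?_, pow_eq_zero_iff two_ne_zero |>.1 ?_,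
    sub_eq_zero.1 (pow_eq_zero_iff two_ne_zero |>.1 ?_)⟩ <;> linarith only [hs, ha, hb, hc, hd,
      he, hf]

/-- The 2-form `P (e¹² + e³⁴)` has the same norm as `e¹² + e³⁴`, so an entry equal to 1 forces the
two to agree. Then `f²` is `f¹` rotated in the planes `e¹²`, `e³⁴`, and `f³ ∧ f⁴ = e¹² + e³⁴ - f¹ ∧
f²`, so everything depends on `x = f¹`. -/
theorem mem_sphere_iff_exists_sphereMatrix {J : Matrix (Fin 6) (Fin 6) ℝ} : J ∈ sphere ↔
    ∃ x : Fin 4 → ℝ, x 0 ^ 2 + x 1 ^ 2 + x 2 ^ 2 + x 3 ^ 2 = 1 ∧ sphereMatrix x = J := by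
  constructor
  · rintro ⟨hJ, P, hP, hs, hf⟩
    have hO := (Matrix.mem_orthogonalGroup_iff' _ _).1
      (Matrix.mem_specialOrthogonalGroup_iff.1 hP).1
    have n := fun i j => congrFun (congrFun hO i) j
    have n00 := n 0 0
    have n11 := n 1 1
    have n22 := n 2 2
    have n33 := n 3 3
    have n01 := n 0 1
    have n02 := n 0 2
    have n03 := n 0 3
    have n12 := n 1 2
    have n13 := n 1 3
    have n23 := n 2 3
    clear n hO
    simp [Matrix.mul_apply, Fin.sum_univ_four] at n00 n11 n22 n33 n01 n02 n03 n12 n13 n23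
    rw [selfDualEntry_eq] at hs
    set s : Fin 4 → Fin 4 → ℝ := fun i j =>
      P i 0 * P j 1 - P j 0 * P i 1 + (P i 2 * P j 3 - P j 2 * P i 3) with hsdef
    have hnorm : s 0 1 ^ 2 + s 0 2 ^ 2 + s 0 3 ^ 2 + s 1 2 ^ 2 + s 1 3 ^ 2 + s 2 3 ^ 2 = 2 := by
      -- The Cauchy–Binet identity expresses the norm of `f¹ ∧ f² + f³ ∧ f⁴` through the inner
      -- products of the columns of `P`.
      have hid : s 0 1 ^ 2 + s 0 2 ^ 2 + s 0 3 ^ 2 + s 1 2 ^ 2 + s 1 3 ^ 2 + s 2 3 ^ 2 =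
          ((P 0 0 * P 0 0 + P 1 0 * P 1 0 + P 2 0 * P 2 0 + P 3 0 * P 3 0) *
            (P 0 1 * P 0 1 + P 1 1 * P 1 1 + P 2 1 * P 2 1 + P 3 1 * P 3 1) -
            (P 0 0 * P 0 1 + P 1 0 * P 1 1 + P 2 0 * P 2 1 + P 3 0 * P 3 1) ^ 2) +
          ((P 0 2 * P 0 2 + P 1 2 * P 1 2 + P 2 2 * P 2 2 + P 3 2 * P 3 2) *
            (P 0 3 * P 0 3 + P 1 3 * P 1 3 + P 2 3 * P 2 3 + P 3 3 * P 3 3) -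
            (P 0 2 * P 0 3 + P 1 2 * P 1 3 + P 2 2 * P 2 3 + P 3 2 * P 3 3) ^ 2) +
          2 * ((P 0 0 * P 0 2 + P 1 0 * P 1 2 + P 2 0 * P 2 2 + P 3 0 * P 3 2) *
            (P 0 1 * P 0 3 + P 1 1 * P 1 3 + P 2 1 * P 2 3 + P 3 1 * P 3 3) -
            (P 0 0 * P 0 3 + P 1 0 * P 1 3 + P 2 0 * P 2 3 + P 3 0 * P 3 3) *
            (P 0 1 * P 0 2 + P 1 1 * P 1 2 + P 2 1 * P 2 2 + P 3 1 * P 3 2)) := by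
        simp only [hsdef]
        ring
      rw [hid, n00, n11, n22, n33, n01, n02, n03, n12, n13, n23]
      norm_num
    have hs2 : s 0 1 + s 2 3 = 2 := by
      simp only [hsdef]
      linarith
    obtain ⟨s01, s02, s03, s12, s13, s23⟩ := eq_of_sum_sq_eq_two hnorm hs2
    simp only [hsdef] at s01 s02 s03 s12 s13 s23
    -- Contracting `s` with the first column of `P` gives minus the second column, by
    -- orthonormality; inserting the known values of `s` yields the four equations.
    have f0 : P 0 1 = -P 1 0 := by
      linear_combination (-P 0 1) * n00 + P 0 0 * n01 - P 0 3 * n02 + P 0 2 * n03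
        - P 1 0 * s01 - P 2 0 * s02 - P 3 0 * s03
    have f1 : P 1 1 = P 0 0 := by
      linear_combination (-P 1 1) * n00 + P 1 0 * n01 - P 1 3 * n02 + P 1 2 * n03
        + P 0 0 * s01 - P 2 0 * s12 - P 3 0 * s13
    have f2 : P 2 1 = -P 3 0 := by
      linear_combination (-P 2 1) * n00 + P 2 0 * n01 - P 2 3 * n02 + P 2 2 * n03
        + P 0 0 * s02 + P 1 0 * s12 - P 3 0 * s23
    have f3 : P 3 1 = P 2 0 := by
      linear_combination (-P 3 1) * n00 + P 3 0 * n01 - P 3 3 * n02 + P 3 2 * n03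
        + P 0 0 * s03 + P 1 0 * s13 + P 2 0 * s23
    rw [f0, f1] at s01
    rw [f2, f3] at s23
    rw [f0, f2] at s02
    rw [f0, f3] at s03
    rw [f1, f2] at s12
    rw [f1, f3] at s13
    refine ⟨fun i => P i 0, by linarith, ?_⟩
    have hform : form (sphereMatrix fun i => P i 0) = form J := by
      rw [hf, paramForm_zero_one, form_sphereMatrix]
      congr 1 <;> linarith
    rw [form_eq_transpose, form_eq_transpose] at hform
    exact transpose_injective hform
  · rintro ⟨x, hx, rfl⟩
    refine ⟨?_, sphereRotation x, sphereRotation_mem hx, ?_, ?_⟩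
    · rw [← structureOf_sphereSpinor hx]
      exact structureOf_mem_acs (sphereSpinor_ne_zero x)
    · rw [selfDualEntry_eq]
      simp [sphereRotation]
      linarith
    · rw [paramForm_zero_one, form_sphereMatrix]
      congr 1 <;> simp [sphereRotation] <;> linarith

theorem Z₂_eq_sphere : Z₂ = sphere := by
  ext J
  rw [mem_Z₂_iff_exists_sphereMatrix, mem_sphere_iff_exists_sphereMatrix]

theorem mem_unitSphere_iff (x : EuclideanSpace ℝ (Fin 4)) :
    x ∈ Metric.sphere (0 : EuclideanSpace ℝ (Fin 4)) 1 ↔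
      x 0 ^ 2 + x 1 ^ 2 + x 2 ^ 2 + x 3 ^ 2 = 1 := by
  rw [mem_sphere_zero_iff_norm, EuclideanSpace.norm_eq, Real.sqrt_eq_one, Fin.sum_univ_four]
  simp

theorem continuous_sphereMatrix : Continuous sphereMatrix := by
  refine continuous_matrix fun i j => ?_
  fin_cases i <;> fin_cases j <;> simp [sphereMatrix, skewMatrix] <;> fun_prop

/-- The set of almost Kähler structures is a 3-sphere. -/
def sphereHomeomorph : sphere ≃ₜ Metric.sphere (0 : EuclideanSpace ℝ (Fin 4)) 1 where
  toFun J := ⟨!₂[J.1 0 4, J.1 1 4, J.1 2 4, J.1 3 4], by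
    obtain ⟨x, hx, h⟩ := mem_sphere_iff_exists_sphereMatrix.1 J.2
    rw [mem_unitSphere_iff, ← h]
    simpa [sphereMatrix, skewMatrix] using hx⟩
  invFun x := ⟨sphereMatrix x.1,
    mem_sphere_iff_exists_sphereMatrix.2 ⟨x.1, (mem_unitSphere_iff _).1 x.2, rfl⟩⟩
  left_inv J := by
    obtain ⟨x, hx, h⟩ := mem_sphere_iff_exists_sphereMatrix.1 J.2
    apply Subtype.ext
    change sphereMatrix ![J.1 0 4, J.1 1 4, J.1 2 4, J.1 3 4] = J.1
    rw [← h]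
    congr 1
    ext i
    fin_cases i <;> simp [sphereMatrix, skewMatrix]
  right_inv x := by
    apply Subtype.ext
    ext i
    fin_cases i <;> simp [sphereMatrix, skewMatrix]
  continuous_toFun := by
    refine Continuous.subtype_mk ?_ _
    refine (PiLp.continuous_toLp 2 _).comp (continuous_pi fun i => ?_)
    fin_cases i <;> exact continuous_subtype_val.matrix_elem _ _
  continuous_invFun := by
    refine Continuous.subtype_mk ?_ _
    exact continuous_sphereMatrix.comp ((PiLp.continuous_ofLp 2 _).comp continuous_subtype_val)

/-! ### Faces, edges and vertices -/

theorem setOf_iEigenspace_eq_image (p : (Fin 4 → ℂ) → Prop) :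
    {J | J ∈ acs ∧ ∃ u : Fin 4 → ℂ, u ≠ 0 ∧ p u ∧ iEigenspace J = isotropicSpace u} =
      structureOf '' {u | u ≠ 0 ∧ p u} := by
  ext J
  constructor
  · rintro ⟨hJ, u, hu, hp, h⟩
    exact ⟨u, ⟨hu, hp⟩, (eq_structureOf hJ hu h).symm⟩
  · rintro ⟨u, ⟨hu, hp⟩, rfl⟩
    exact ⟨structureOf_mem_acs hu, u, hu, hp, iEigenspace_structureOf hu⟩

theorem face_eq_image (i : Fin 4) : face i = structureOf '' {u | u ≠ 0 ∧ u i = 0} :=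
  setOf_iEigenspace_eq_image fun u => u i = 0

theorem edge_eq_image (i j : Fin 4) :
    edge i j = structureOf '' {u | u ≠ 0 ∧ ∀ k, k ≠ i → k ≠ j → u k = 0} :=
  setOf_iEigenspace_eq_image fun u => ∀ k, k ≠ i → k ≠ j → u k = 0

theorem vertexSet_eq_image (i : Fin 4) :
    vertexSet i = structureOf '' {u | u ≠ 0 ∧ ∀ k, k ≠ i → u k = 0} := by
  have hs : (Pi.single i 1 : Fin 4 → ℂ) ≠ 0 := by simp
  ext J
  constructor
  · rintro ⟨-, h⟩
    refine ⟨Pi.single i 1, ⟨hs, fun k hk => Pi.single_eq_of_ne hk _⟩, ?_⟩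
    rw [← form_structureOf_single, form_eq_transpose, form_eq_transpose] at h
    exact (transpose_injective h).symm
  · rintro ⟨u, ⟨hu, h⟩, rfl⟩
    refine ⟨structureOf_mem_acs hu, ?_⟩
    have hui : u = u i • (Pi.single i 1 : Fin 4 → ℂ) := by
      ext k
      by_cases hk : k = i
      · subst hk
        simp
      · simp [h k hk, hk]
    have hi : u i ≠ 0 := fun h0 => hu (by rw [hui, h0, zero_smul])
    rw [hui, structureOf_smul hi, form_structureOf_single]

/-- Every set in the theorem becomes an image under `structureOf`, so the equalities of classes
reduce to equalities of conditions on `u`. -/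
theorem eq_image_structureOf {S : Set (Matrix (Fin 6) (Fin 6) ℝ)} (hS : S ⊆ acs)
    {p : (Fin 4 → ℂ) → Prop} (h : ∀ {u}, u ≠ 0 → (structureOf u ∈ S ↔ p u)) :
    S = structureOf '' {u | u ≠ 0 ∧ p u} := by
  ext J
  constructor
  · intro hJ
    obtain ⟨u, hu, rfl⟩ := exists_structureOf (hS hJ)
    exact ⟨u, ⟨hu, (h hu).1 hJ⟩, rfl⟩
  · rintro ⟨u, ⟨hu, hp⟩, rfl⟩
    exact (h hu).2 hp

theorem grayHervellaClass_subset (U : Matrix (Fin 6) (Fin 6) ℝ → Submodule ℝ Tensor3) :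
    grayHervellaClass U ⊆ acs := fun _ h => h.1

theorem image_structureOf_or (p q : (Fin 4 → ℂ) → Prop) :
    structureOf '' {u | u ≠ 0 ∧ (p u ∨ q u)} =
      structureOf '' {u | u ≠ 0 ∧ p u} ∪ structureOf '' {u | u ≠ 0 ∧ q u} := by
  rw [← Set.image_union]
  congr 1
  ext u
  exact and_or_left

theorem Z₂₃₄_eq : Z₂₃₄ = face 3 := by
  rw [face_eq_image]
  exact eq_image_structureOf (grayHervellaClass_subset _) structureOf_mem_Z₂₃₄

theorem Z₁₃₄_eq : Z₁₃₄ = vertexSet 0 ∪ edge 1 2 := by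
  rw [eq_image_structureOf (S := Z₁₃₄) (grayHervellaClass_subset _) structureOf_mem_Z₁₃₄,
    image_structureOf_or,
    vertexSet_eq_image, edge_eq_image]
  simp [Fin.forall_fin_succ]

theorem Z₁₂₄_eq : Z₁₂₄ = vertexSet 3 ∪ sphere := by
  rw [eq_image_structureOf (S := Z₁₂₄) (grayHervellaClass_subset _) structureOf_mem_Z₁₂₄,
    image_structureOf_or,
    ← eq_image_structureOf (S := Z₂) (grayHervellaClass_subset _) structureOf_mem_Z₂,
      vertexSet_eq_image, Z₂_eq_sphere]
  simp [Fin.forall_fin_succ]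

theorem Z₁₂₃_eq : Z₁₂₃ = face 0 ∪ face 3 := by
  rw [eq_image_structureOf (S := Z₁₂₃) (grayHervellaClass_subset _) structureOf_mem_Z₁₂₃,
    image_structureOf_or,
    face_eq_image, face_eq_image]

end Iwasawa

end


theorem theorem1 :
    (∃ Φ : Projectivization ℂ (Fin 4 → ℂ) ≃ Iwasawa.acs,
      (∀ (u : Fin 4 → ℂ) (hu : u ≠ 0),
        Iwasawa.iEigenspace (Φ (Projectivization.mk ℂ u hu)).1 = Iwasawa.isotropicSpace u) ∧
      ∀ (i : Fin 4) (hi : (Pi.single i 1 : Fin 4 → ℂ) ≠ 0),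
        Iwasawa.form (Φ (Projectivization.mk ℂ (Pi.single i 1) hi)).1 = Iwasawa.vertexForm i) ∧
    Iwasawa.Z₂₃₄ = Iwasawa.face 3 ∧
    Iwasawa.Z₁₃₄ = Iwasawa.vertexSet 0 ∪ Iwasawa.edge 1 2 ∧
    Iwasawa.Z₁₂₄ = Iwasawa.vertexSet 3 ∪ Iwasawa.sphere ∧
    Iwasawa.Z₁₂₃ = Iwasawa.face 0 ∪ Iwasawa.face 3 ∧
    Iwasawa.Z₂ = Iwasawa.sphere ∧
    Nonempty (Iwasawa.sphere ≃ₜ Metric.sphere (0 : EuclideanSpace ℝ (Fin 4)) 1) :=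
  ⟨⟨Iwasawa.kleinEquiv, fun _ hu => Iwasawa.iEigenspace_structureOf hu,
      fun i _ => Iwasawa.form_structureOf_single i⟩,
    Iwasawa.Z₂₃₄_eq, Iwasawa.Z₁₃₄_eq, Iwasawa.Z₁₂₄_eq, Iwasawa.Z₁₂₃_eq, Iwasawa.Z₂_eq_sphere,
    ⟨Iwasawa.sphereHomeomorph⟩⟩
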